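/- Let $\lambda>0$ and $0<r<\mu$, and put $d=1/r$. Let $N(t)$, $t\ge 0$, be a Poisson process with rate $\lambda$, that is, $N(t)=\#\{n\ge 1: s_n\le t\}$ where $s_n$ is the sum of the first $n$ of a sequence of i.i.d. exponential interarrival times with mean $1/\lambda$. For $i\ge 1$ the process is sampled at time $t_i=id$, and the sample $N(t_i)$ is sent to a single first-in-first-out server with unlimited buffer, initially empty. The service times $v_1,v_2,\dots$ are i.i.d. exponential with mean $1/\mu$ and independent of $N$. Thus the $i$-th sample is received at time $t'_i=\max(t_i,t'_{i-1})+v_i$, with $t'_0=0$. Let $\hat N(t)$ be the value of the latest sample received by time $t$ (and $\hat N(t)=0$ if none has been received), and let $D(t)=N(t)-\hat N(t)$. Then, almost surely, $D$ is integrable on $[0,T]$ for every $T>0$, and the long-run average distortion exists and equals $$\Theta(r)=\lim_{T\to\infty}\frac1T\int_0^T D(t)\,dt=\lambda\left(\frac{1}{2r}+\frac{\sigma}{\mu(1-\sigma)}+\frac1\mu\right),\qquad \sigma=-\frac{r}{\mu}\,W\!\left(-\frac{\mu}{r}e^{-\mu/r}\right),$$ where $W$ is the principal branch of the Lambert $W$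 function (for $x\ge -1/e$, $W(x)$ is the unique $w\ge -1$ with $we^w=x$). -/

import Mathlib

open MeasureTheory ProbabilityTheory Filter Topology

noncomputable section

/-- The principal branch of the Lambert `W` function: for `x ≥ -1/e`, the unique `w ≥ -1` with
`w * exp w = x` (the two lemmas below). For `x < -1/e` the value is junk. -/
def lambertW (x : ℝ) : ℝ :=
  Function.invFunOn (fun w : ℝ => w * Real.exp w) (Set.Ici (-1)) x

theorem lambertW_spec {x : ℝ} (hx : -Real.exp (-1) ≤ x) :
    -1 ≤ lambertW x ∧ lambertW x * Real.exp (lambertW x) = x := by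
  have hex : ∃ w ∈ Set.Ici (-1 : ℝ), (fun w : ℝ => w * Real.exp w) w = x := by
    have hb : (-1 : ℝ) ≤ max x 0 := le_trans (by norm_num) (le_max_right x 0)
    have hc : ContinuousOn (fun w : ℝ => w * Real.exp w) (Set.Icc (-1) (max x 0)) := by fun_prop
    have hm : x ∈ Set.Icc ((-1 : ℝ) * Real.exp (-1)) (max x 0 * Real.exp (max x 0)) := by
      refine ⟨by linarith, ?_⟩
      have h1 : 1 ≤ Real.exp (max x 0) := Real.one_le_exp (le_max_right x 0)
      nlinarith [le_max_left x 0, le_max_right x 0]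
    obtain ⟨w, hw, hwx⟩ := intermediate_value_Icc hb hc hm
    exact ⟨w, hw.1, hwx⟩
  exact ⟨Function.invFunOn_mem hex, Function.invFunOn_eq hex⟩

theorem lambertW_mul_exp {w : ℝ} (hw : -1 ≤ w) : lambertW (w * Real.exp w) = w := by
  have hmono : StrictMonoOn (fun w : ℝ => w * Real.exp w) (Set.Ici (-1)) := by
    refine strictMonoOn_of_deriv_pos (convex_Ici _) (by fun_prop) fun y hy => ?_
    rw [interior_Ici, Set.mem_Ioi] at hy
    have h : HasDerivAt (fun w : ℝ => w * Real.exp w) (1 * Real.exp y + y * Real.exp y) y :=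
      (hasDerivAt_id y).mul (Real.hasDerivAt_exp y)
    rw [h.deriv]
    nlinarith [Real.exp_pos y]
  exact hmono.injOn.leftInvOn_invFunOn hw

variable {Ω : Type*}

/-- Time `s_n` of the `n`-th event of the source, `s_0 = 0`; `X k` is the interarrival time
between the events `k` and `k + 1`. -/
def eventTime (X : ℕ → Ω → ℝ) (n : ℕ) (ω : Ω) : ℝ :=
  ∑ k ∈ Finset.range n, X k ω

/-- The counting process `N(t)`: the number of events `n ≥ 1` with `s_n ≤ t`. -/
def countingProcess (X : ℕ → Ω → ℝ) (t : ℝ) (ω : Ω) : ℕ :=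
  Set.ncard {n : ℕ | 1 ≤ n ∧ eventTime X n ω ≤ t}

/-- Time `t'_i` at which the monitor receives the `i`-th sample, `i ≥ 1`. The sample is taken at
time `i * d`, its service starts as soon as it has been taken and the previous sample has left the
single first-in-first-out server, and it takes `V (i - 1)`. Index `0` stands for the initial
knowledge `N(0) = 0` of the monitor, available at time `0` without service. -/
def deliveryTime (d : ℝ) (V : ℕ → Ω → ℝ) : ℕ → Ω → ℝ
  | 0, _ => 0
  | i + 1, ω => max (((i + 1 : ℕ) : ℝ) * d) (deliveryTime d V i ω) + V i ω

/-- Index of the latest sample that the monitor has received by time `t` (`0` if none). -/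
def latestReceived (d : ℝ) (V : ℕ → Ω → ℝ) (t : ℝ) (ω : Ω) : ℕ :=
  sSup {i : ℕ | deliveryTime d V i ω ≤ t}

/-- The reconstructed process: the value `N(i * d)` of the latest received sample `i`. -/
def reconstructedProcess (d : ℝ) (X V : ℕ → Ω → ℝ) (t : ℝ) (ω : Ω) : ℕ :=
  countingProcess X ((latestReceived d V t ω : ℝ) * d) ω

/-- The real-time distortion `D(t)`, the source minus its reconstruction. -/
def distortion (d : ℝ) (X V : ℕ → Ω → ℝ) (t : ℝ) (ω : Ω) : ℝ :=
  (countingProcess X t ω : ℝ) - (reconstructedProcess d X V t ω : ℝ)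

/-- The average distortion over the time horizon `[0, T]`. -/
def averageDistortion (d : ℝ) (X V : ℕ → Ω → ℝ) (T : ℝ) (ω : Ω) : ℝ :=
  1 / T * ∫ t in (0 : ℝ)..T, distortion d X V t ω

end

/-! ### The exponential distribution -/

/-! An event at time s becomes known to the monitor when the first sample taken at or after s,
sample number ⌈s/d⌉, is delivered. So D(t) counts the events whose delay interval [s, s + J)
contains t, and ∫₀ᵀ D is, up to boundary terms, the sum of the delays J of the events before T. As
in Little's law, the long-run average is λ times the mean delay per event
(`tendsto_averageDistortion`).

For fixed service times, J is the value at s of the function `eventDelay`: the wait until the next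
sampling time plus the sojourn time of that sample. Its time average is the mean sojourn time plus
d/2. Poisson arrivals see this time average: the exponential law has constant hazard rate, so each
delay minus λ times the integral of `eventDelay` over the preceding interarrival interval is
orthogonal to the past (`integral_mul_increment_eq_zero`). These compensators add up to λ ∫
`eventDelay` over [0, s_m], and the orthogonal differences average out.

The sojourn times are those of a D/M/1 queue. The exponential law of rate θ is stationary when
exp(-θd) = (μ - θ)/μ (`hasLaw_max_sub_add`); with θ = μ(1 - σ) this is the Lambert equation for σ.
Restarting the queue from an empty state at customer i changes later sojourn times by a
geometrically small amount (`integral_coupling_le`). This yields decaying correlations in the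
stationary queue, and it transfers the average 1/θ to the queue that starts empty.

Both strong laws use the same scheme: partial sums have second moments of order m, hence converge
almost surely along squares after division by m, and monotonicity fills the gaps. The given space
need not carry a stationary initial state, so the average delay is found on an auxiliary space and
transferred through the joint law of `X` and `V`. -/

open scoped ENNReal in
theorem lintegral_expMeasure (a : ℝ) (f : ℝ → ℝ≥0∞) (hf : Measurable f) :
    ∫⁻ x, f x ∂(expMeasure a) =
      ∫⁻ x in Set.Ioi 0, ENNReal.ofReal (a * Real.exp (-(a * x))) * f x := by
  have h1 : expMeasure a = volume.withDensity (exponentialPDF a) := rfl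
  have hm : Measurable (exponentialPDF a) :=
    (measurable_exponentialPDFReal a).ennreal_ofReal
  rw [h1, lintegral_withDensity_eq_lintegral_mul _ hm hf,
    ← lintegral_add_compl _ (measurableSet_Ici (a := (0 : ℝ))), Set.compl_Ici,
    setLIntegral_congr (Ioi_ae_eq_Ici (a := (0 : ℝ))).symm]
  have h2 : ∫⁻ x in Set.Iio (0 : ℝ), (exponentialPDF a * f) x = 0 := by
    rw [setLIntegral_congr_fun measurableSet_Iio (g := fun _ => 0), lintegral_zero]
    intro x hx
    simp [exponentialPDF_of_neg hx]
  rw [h2, add_zero]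
  refine setLIntegral_congr_fun measurableSet_Ioi fun x hx => ?_
  simp [exponentialPDF_of_nonneg (le_of_lt (Set.mem_Ioi.1 hx))]

theorem expMeasure_Ioi {a : ℝ} (ha : 0 < a) (t : ℝ) :
    expMeasure a (Set.Ioi t) = ENNReal.ofReal (Real.exp (-(a * max t 0))) := by
  have := isProbabilityMeasure_expMeasure ha
  have h1 : expMeasure a (Set.Iic t) =
      ENNReal.ofReal (if 0 ≤ t then 1 - Real.exp (-(a * t)) else 0) := by
    rw [← cdf_expMeasure_eq ha t, ofReal_cdf]
  rw [← Set.compl_Iic, prob_compl_eq_one_sub measurableSet_Iic, h1,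
    ← ENNReal.ofReal_one, ← ENNReal.ofReal_sub]
  · congr 1
    split_ifs with h
    · rw [max_eq_left h]; ring
    · rw [max_eq_right (by linarith)]; simp
  · split_ifs with h
    · have : Real.exp (-(a * t)) ≤ 1 := Real.exp_le_one_iff.2 (by nlinarith)
      linarith
    · exact le_rfl

theorem ae_pos_expMeasure {a : ℝ} (ha : 0 < a) : ∀ᵐ x ∂(expMeasure a), 0 < x := by
  have := isProbabilityMeasure_expMeasure ha
  have h : expMeasure a (Set.Ioi 0) = 1 := by rw [expMeasure_Ioi ha]; simp
  exact (prob_compl_eq_zero_iff measurableSet_Ioi).2 h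

theorem lintegral_exp_mul_expMeasure {a t : ℝ} (ha : 0 < a) (ht : t < a) :
    ∫⁻ x, ENNReal.ofReal (Real.exp (t * x)) ∂(expMeasure a) = ENNReal.ofReal (a / (a - t)) := by
  rw [lintegral_expMeasure _ _ (by fun_prop)]
  have h1 : ∀ x : ℝ, ENNReal.ofReal (a * Real.exp (-(a * x))) * ENNReal.ofReal (Real.exp (t * x)) =
      ENNReal.ofReal (a * Real.exp ((t - a) * x)) := fun x => by
    rw [← ENNReal.ofReal_mul (by positivity), mul_assoc, ← Real.exp_add]
    ring_nf
  simp_rw [h1]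
  have hlt : t - a < 0 := by linarith
  rw [← ofReal_integral_eq_lintegral_ofReal]
  · rw [integral_const_mul, integral_exp_mul_Ioi hlt]
    congr 1
    have : a - t ≠ 0 := by linarith
    have : t - a ≠ 0 := by linarith
    simp only [mul_zero, Real.exp_zero]
    field_simp
    ring
  · exact (integrableOn_exp_mul_Ioi hlt 0).const_mul _
  · exact ae_of_all _ fun x => by positivity

theorem integrable_exp_mul_expMeasure {a t : ℝ} (ha : 0 < a) (ht : t < a) :
    Integrable (fun x => Real.exp (t * x)) (expMeasure a) := by
  refine ⟨by fun_prop, ?_⟩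
  rw [hasFiniteIntegral_iff_ofReal (ae_of_all _ fun x => (Real.exp_pos _).le),
    lintegral_exp_mul_expMeasure ha ht]
  exact ENNReal.ofReal_lt_top

theorem memLp_two_expMeasure {a : ℝ} (ha : 0 < a) : MemLp (fun x : ℝ => x) 2 (expMeasure a) := by
  refine memLp_of_mem_interior_integrableExpSet (X := fun x : ℝ => x) ?_ 2
  refine mem_interior.2 ⟨Set.Iio a, fun t ht => integrable_exp_mul_expMeasure ha ht, isOpen_Iio, ha⟩

theorem integral_id_expMeasure {a : ℝ} (ha : 0 < a) : ∫ x, x ∂(expMeasure a) = 1 / a := by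
  rw [integral_eq_lintegral_of_nonneg_ae
    ((ae_pos_expMeasure ha).mono fun x hx => le_of_lt hx) (by fun_prop),
    lintegral_expMeasure _ _ (by fun_prop)]
  have h := Real.integral_rpow_mul_exp_neg_mul_Ioi (a := 2) (r := a) (by norm_num) ha
  rw [setLIntegral_congr_fun (g := fun x => ENNReal.ofReal
    (a * (x ^ ((2 : ℝ) - 1) * Real.exp (-(a * x))))) measurableSet_Ioi, 
    ← integral_eq_lintegral_of_nonneg_ae, integral_const_mul, h, Real.Gamma_two]
  · have : (2 : ℝ) = ((2 : ℕ) : ℝ) := by norm_num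
    rw [this, Real.rpow_natCast]
    field_simp
  · refine (ae_restrict_iff' measurableSet_Ioi).2 (ae_of_all _ fun x hx => ?_)
    have : (0 : ℝ) < x := hx
    positivity
  · fun_prop
  · intro x hx
    simp only
    rw [← ENNReal.ofReal_mul (by positivity)]
    congr 1
    norm_num
    ring

/-- Constant hazard rate: by Tonelli the right side weights ψ(u) by a times the tail probability
exp(-au), which is the density at u. This is what makes `compensator` compensate `jump`. -/
theorem integral_expMeasure_eq_integral_primitive {a : ℝ} (ha : 0 < a) {ψ : ℝ → ℝ}
    (hψ : Measurable ψ) (h0 : ∀ x, 0 ≤ ψ x) (hi : ∀ x y, IntervalIntegrable ψ volume x y) :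
    ∫ x, ψ x ∂(expMeasure a) = ∫ x, (a * ∫ u in (0 : ℝ)..x, ψ u) ∂(expMeasure a) := by
  have := isProbabilityMeasure_expMeasure ha
  have hcont : Continuous fun x => ∫ u in (0 : ℝ)..x, ψ u :=
    intervalIntegral.continuous_primitive hi 0
  have hpos := ae_pos_expMeasure ha
  rw [integral_eq_lintegral_of_nonneg_ae (ae_of_all _ h0) hψ.aestronglyMeasurable,
    integral_eq_lintegral_of_nonneg_ae]
  rotate_left
  · filter_upwards [hpos] with x hx
    exact mul_nonneg ha.le (intervalIntegral.integral_nonneg hx.le fun u _ => h0 u)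
  · exact (hcont.const_mul a).aestronglyMeasurable
  -- Equality is proved for the lower integrals, so no integrability of ψ under the exponential law
  -- is needed.
  congr 1
  set D : Set (ℝ × ℝ) := {p | 0 < p.2 ∧ p.2 < p.1} with hD
  have hDm : MeasurableSet D :=
    (measurableSet_lt measurable_const measurable_snd).inter
      (measurableSet_lt measurable_snd measurable_fst)
  set k : ℝ × ℝ → ENNReal := D.indicator fun p => ENNReal.ofReal a * ENNReal.ofReal (ψ p.2) with hk
  have hkm : Measurable k := Measurable.indicator (by fun_prop) hDm
  have h1 : ∀ᵐ x ∂(expMeasure a), ENNReal.ofReal (a * ∫ u in (0 : ℝ)..x, ψ u) =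
      ∫⁻ u, k (x, u) := by
    filter_upwards [hpos] with x hx
    have hx' : (fun u => k (x, u)) =
        (Set.Ioo 0 x).indicator fun u => ENNReal.ofReal a * ENNReal.ofReal (ψ u) := by
      funext u
      simp only [hk, hD, Set.indicator_apply, Set.mem_ofPred_eq, Set.mem_Ioo]
    rw [hx', lintegral_indicator measurableSet_Ioo, lintegral_const_mul _ (by fun_prop),
      ENNReal.ofReal_mul ha.le, intervalIntegral.integral_of_le hx.le,
      ofReal_integral_eq_lintegral_ofReal (hi 0 x).1 (ae_of_all _ h0),
      setLIntegral_congr Ioo_ae_eq_Ioc]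
  rw [lintegral_congr_ae h1, lintegral_lintegral_swap (f := fun x u => k (x, u)) hkm.aemeasurable,
    lintegral_expMeasure _ _ (by fun_prop), ← lintegral_indicator measurableSet_Ioi]
  refine lintegral_congr fun u => ?_
  by_cases hu : 0 < u
  · have h2 : (fun x => k (x, u)) =
        (Set.Ioi u).indicator fun _ => ENNReal.ofReal a * ENNReal.ofReal (ψ u) := by
      funext x
      simp only [hk, hD, Set.indicator_apply, Set.mem_ofPred_eq, Set.mem_Ioi, hu, true_and]
    rw [h2, lintegral_indicator measurableSet_Ioi, setLIntegral_const, expMeasure_Ioi ha,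
      max_eq_left hu.le, Set.indicator_of_mem (Set.mem_Ioi.2 hu), ENNReal.ofReal_mul ha.le]
    ring
  · have h2 : ∀ x, k (x, u) = 0 := fun x => by
      rw [hk, Set.indicator_of_notMem]
      exact fun h => hu h.1
    rw [Set.indicator_of_notMem (by simpa using hu)]
    simp [h2]

/-- Tail of max(S - d, 0) + V at t, conditioned on V = v: it is 1 if v > t, and otherwise the
exponential tail of S at t - v + d. The condition on θ turns the part v ≤ t into exp(-θt) -
exp(-μt), and v > t contributes exp(-μt). -/
theorem lintegral_expMeasure_Ioi_shift {θ μ d t : ℝ} (hμ : 0 < μ) (hθμ : θ < μ)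
    (hθ : Real.exp (-(θ * d)) = (μ - θ) / μ) (ht : 0 ≤ t) :
    ∫⁻ v, (if t < v then 1 else ENNReal.ofReal (Real.exp (-(θ * (t - v + d))))) ∂(expMeasure μ) =
      ENNReal.ofReal (Real.exp (-(θ * t))) := by
  have hm : Measurable fun v : ℝ =>
      (if t < v then (1 : ENNReal) else ENNReal.ofReal (Real.exp (-(θ * (t - v + d))))) :=
    Measurable.ite measurableSet_Ioi measurable_const (by fun_prop)
  rw [← lintegral_add_compl _ (measurableSet_Ioi (a := t)), Set.compl_Ioi]
  have h1 : ∫⁻ v in Set.Ioi t, (if t < v then (1 : ENNReal)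
      else ENNReal.ofReal (Real.exp (-(θ * (t - v + d))))) ∂(expMeasure μ) =
      ENNReal.ofReal (Real.exp (-(μ * t))) := by
    rw [setLIntegral_congr_fun (g := fun _ => 1) measurableSet_Ioi fun v hv =>
      if_pos (Set.mem_Ioi.1 hv)]
    rw [setLIntegral_one, expMeasure_Ioi hμ, max_eq_left ht]
  have h2 : ∫⁻ v in Set.Iic t, (if t < v then (1 : ENNReal)
      else ENNReal.ofReal (Real.exp (-(θ * (t - v + d))))) ∂(expMeasure μ) =
      ENNReal.ofReal (Real.exp (-(θ * t)) - Real.exp (-(μ * t))) := by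
    rw [← lintegral_indicator measurableSet_Iic, lintegral_expMeasure _ _
      (hm.indicator measurableSet_Iic), ← lintegral_indicator measurableSet_Ioi]
    have h3 : ∀ v, (Set.Ioi (0 : ℝ)).indicator (fun x => ENNReal.ofReal (μ * Real.exp (-(μ * x))) *
        (Set.Iic t).indicator (fun v => if t < v then (1 : ENNReal)
          else ENNReal.ofReal (Real.exp (-(θ * (t - v + d))))) x) v =
        (Set.Ioc 0 t).indicator (fun x => ENNReal.ofReal
          (Real.exp (-(θ * t)) * ((μ - θ) * Real.exp (-((μ - θ) * x))))) v := by
      intro v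
      by_cases hv : 0 < v
      · by_cases hvt : v ≤ t
        · rw [Set.indicator_of_mem (Set.mem_Ioi.2 hv), Set.indicator_of_mem (Set.mem_Iic.2 hvt),
            Set.indicator_of_mem (Set.mem_Ioc.2 ⟨hv, hvt⟩), if_neg (not_lt.2 hvt),
            ← ENNReal.ofReal_mul (by positivity)]
          congr 1
          have e1 : Real.exp (-(θ * (t - v + d))) =
              Real.exp (-(θ * t)) * Real.exp (θ * v) * Real.exp (-(θ * d)) := by
            rw [← Real.exp_add, ← Real.exp_add]; ring_nf
          have e2 : Real.exp (-((μ - θ) * v)) = Real.exp (-(μ * v)) * Real.exp (θ * v) := by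
            rw [← Real.exp_add]; ring_nf
          rw [e1, e2, hθ]
          field_simp
        · rw [Set.indicator_of_mem (Set.mem_Ioi.2 hv), Set.indicator_of_notMem (by simpa using hvt),
            Set.indicator_of_notMem (by simp [hvt]), mul_zero]
      · rw [Set.indicator_of_notMem (by simpa using hv), Set.indicator_of_notMem (by simp [hv])]
    rw [lintegral_congr h3, lintegral_indicator measurableSet_Ioc,
      ← ofReal_integral_eq_lintegral_ofReal, ← intervalIntegral.integral_of_le ht]
    · congr 1
      rw [intervalIntegral.integral_const_mul,
        intervalIntegral.integral_eq_sub_of_hasDerivAt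
          (f := fun x => -Real.exp (-((μ - θ) * x))) (fun x _ => hasDerivAt_neg_exp_mul_exp)
          (by apply Continuous.intervalIntegrable; fun_prop)]
      have e3 : Real.exp (-(μ * t)) = Real.exp (-(θ * t)) * Real.exp (-((μ - θ) * t)) := by
        rw [← Real.exp_add]; ring_nf
      rw [e3]
      simp
      ring
    · exact (Continuous.integrableOn_Icc (by fun_prop)).mono_set Set.Ioc_subset_Icc_self
    · refine ae_of_all _ fun x => ?_
      have : 0 < μ - θ := by linarith
      positivity
  rw [h1, h2, ← ENNReal.ofReal_add (by positivity)]
  · ring_nf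
  · have : Real.exp (-(μ * t)) ≤ Real.exp (-(θ * t)) := Real.exp_le_exp.2 (by nlinarith)
    linarith

/-- The exponential law of rate `θ` is stationary for the sojourn times of the D/M/1 queue. -/
theorem hasLaw_max_sub_add {Ω : Type*} [MeasurableSpace Ω] {P : Measure Ω} [IsProbabilityMeasure P]
    {θ μ d : ℝ} (hθ0 : 0 < θ) (hd : 0 < d) (hθμ : θ < μ)
    (hθ : Real.exp (-(θ * d)) = (μ - θ) / μ) {S V : Ω → ℝ}
    (hSm : Measurable S) (hVm : Measurable V) (hS : HasLaw S (expMeasure θ) P)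
    (hV : HasLaw V (expMeasure μ) P)
    (h : IndepFun S V P) : HasLaw (fun ω => max (S ω - d) 0 + V ω) (expMeasure θ) P := by
  have hμ : 0 < μ := hθ0.trans hθμ
  have iθ := isProbabilityMeasure_expMeasure hθ0
  have iμ := isProbabilityMeasure_expMeasure hμ
  have hTm : Measurable fun ω => max (S ω - d) 0 + V ω := by fun_prop
  refine ⟨hTm.aemeasurable, ?_⟩
  have iT : IsProbabilityMeasure (P.map fun ω => max (S ω - d) 0 + V ω) :=
    Measure.isProbabilityMeasure_map hTm.aemeasurable
  refine Measure.ext_of_Iic _ _ fun t => ?_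
  rw [← Set.compl_Ioi, prob_compl_eq_one_sub measurableSet_Ioi,
    prob_compl_eq_one_sub measurableSet_Ioi]
  congr 1
  have hlaw : P.map (fun ω => (V ω, S ω)) = (expMeasure μ).prod (expMeasure θ) := by
    rw [h.symm.map_prod_eq_prod_map_map hVm.aemeasurable hSm.aemeasurable, hS.map_eq, hV.map_eq]
  have hset : MeasurableSet {p : ℝ × ℝ | t < max (p.2 - d) 0 + p.1} :=
    measurableSet_lt measurable_const (by fun_prop)
  rw [Measure.map_apply hTm measurableSet_Ioi]
  have e1 : (fun ω => max (S ω - d) 0 + V ω) ⁻¹' Set.Ioi t =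
      (fun ω => (V ω, S ω)) ⁻¹' {p : ℝ × ℝ | t < max (p.2 - d) 0 + p.1} := rfl
  rw [e1, ← Measure.map_apply (by fun_prop) hset, hlaw, Measure.prod_apply hset,
    expMeasure_Ioi hθ0]
  have hpre : ∀ v : ℝ, Prod.mk v ⁻¹' {p : ℝ × ℝ | t < max (p.2 - d) 0 + p.1} =
      if t < v then Set.univ else Set.Ioi (t - v + d) := by
    intro v
    split_ifs with hv
    · ext s
      simp only [Set.mem_preimage, Set.mem_ofPred_eq, Set.mem_univ, iff_true]
      linarith [le_max_right (s - d) 0]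
    · ext s
      simp only [Set.mem_preimage, Set.mem_ofPred_eq, Set.mem_Ioi]
      rw [← sub_lt_iff_lt_add, lt_max_iff]
      constructor
      · rintro (h | h) <;> linarith
      · intro h; left; linarith
  rcases le_or_gt 0 t with ht | ht
  · rw [max_eq_left ht, ← lintegral_expMeasure_Ioi_shift hμ hθμ hθ ht]
    refine lintegral_congr fun v => ?_
    rw [hpre v]
    split_ifs with hv
    · exact measure_univ
    · rw [expMeasure_Ioi hθ0, max_eq_left (by linarith)]
  · rw [max_eq_right ht.le]
    have : ∀ᵐ v ∂(expMeasure μ), expMeasure θ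
        (Prod.mk v ⁻¹' {p : ℝ × ℝ | t < max (p.2 - d) 0 + p.1}) = 1 := by
      filter_upwards [ae_pos_expMeasure hμ] with v hv
      rw [hpre v, if_pos (by linarith)]
      exact measure_univ
    rw [lintegral_congr_ae this]
    simp

/-! ### Almost sure convergence from second moments -/

/-- The sum of the functions has finite integral, so it is finite almost everywhere and its terms
tend to 0. -/
theorem ae_tendsto_zero_of_tsum_lintegral_ne_top {Ω : Type*} [MeasurableSpace Ω] {P : Measure Ω}
    {f : ℕ → Ω → ENNReal} (hf : ∀ n, AEMeasurable (f n) P) (h : ∑' n, ∫⁻ ω, f n ω ∂P ≠ ⊤) :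
    ∀ᵐ ω ∂P, Tendsto (fun n => f n ω) atTop (𝓝 0) := by
  rw [← lintegral_tsum hf] at h
  filter_upwards [ae_lt_top' (AEMeasurable.tsum hf) h] with ω hω
  exact ENNReal.tendsto_atTop_zero_of_tsum_ne_top hω.ne

theorem tendsto_zero_of_tendsto_ofReal_sq {u : ℕ → ℝ}
    (h : Tendsto (fun n => ENNReal.ofReal (u n ^ 2)) atTop (𝓝 0)) : Tendsto u atTop (𝓝 0) := by
  have h1 : Tendsto (fun n => (ENNReal.ofReal (u n ^ 2)).toReal) atTop (𝓝 0) := by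
    simpa [Function.comp_def] using (ENNReal.tendsto_toReal ENNReal.zero_ne_top).comp h
  have h2 : Tendsto (fun n => Real.sqrt (u n ^ 2)) atTop (𝓝 0) := by
    have h3 : Tendsto (fun n => u n ^ 2) atTop (𝓝 0) :=
      h1.congr fun n => ENNReal.toReal_ofReal (sq_nonneg _)
    simpa [Function.comp_def] using (Real.continuous_sqrt.tendsto 0).comp h3
  exact (tendsto_zero_iff_abs_tendsto_zero _).2 (h2.congr fun n => Real.sqrt_sq_eq_abs _)

theorem ae_tendsto_zero_of_integral_sq_le {Ω : Type*} [MeasurableSpace Ω] {P : Measure Ω}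
    {Z : ℕ → Ω → ℝ} (hZ : ∀ n, MemLp (Z n) 2 P) {b : ℕ → ℝ} (hb : Summable b)
    (h : ∀ n, ∫ ω, Z n ω ^ 2 ∂P ≤ b n) : ∀ᵐ ω ∂P, Tendsto (fun n => Z n ω) atTop (𝓝 0) := by
  have h1 : ∀ n, ∫⁻ ω, ENNReal.ofReal (Z n ω ^ 2) ∂P ≤ ENNReal.ofReal (b n) := fun n => by
    rw [← ofReal_integral_eq_lintegral_ofReal (hZ n).integrable_sq
      (ae_of_all _ fun ω => sq_nonneg _)]
    exact ENNReal.ofReal_le_ofReal (h n)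
  have h2 := ae_tendsto_zero_of_tsum_lintegral_ne_top
    (f := fun n ω => ENNReal.ofReal (Z n ω ^ 2)) (P := P)
    (fun n => (((hZ n).1.aemeasurable).pow_const 2).ennreal_ofReal)
    (ne_top_of_le_ne_top hb.tsum_ofReal_ne_top (ENNReal.tsum_le_tsum h1))
  filter_upwards [h2] with ω hω
  exact tendsto_zero_of_tendsto_ofReal_sq hω

/-- Rajchman's bound for sequences with geometrically decaying correlations. -/
theorem integral_sum_sq_le {Ω : Type*} [MeasurableSpace Ω] {P : Measure Ω}
    {Y : ℕ → Ω → ℝ} (hY : ∀ i, MemLp (Y i) 2 P) {c p : ℝ} (hp0 : 0 ≤ p) (hp1 : p < 1) 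
    (hc : 0 ≤ c) (h : ∀ i k, ∫ ω, Y i ω * Y (i + k) ω ∂P ≤ c * p ^ k) (m : ℕ) :
    ∫ ω, (∑ i ∈ Finset.range m, Y i ω) ^ 2 ∂P ≤ (c + 2 * (c * (1 - p)⁻¹)) * m := by
  induction m with
  | zero => simp
  | succ m ih =>
    have hS : MemLp (fun ω => ∑ i ∈ Finset.range m, Y i ω) 2 P :=
      memLp_finsetSum _ fun i _ => hY i
    have hi : ∀ i j, Integrable (fun ω => Y i ω * Y j ω) P := fun i j =>
      (hY i).integrable_mul (hY j)
    have e : ∀ ω, (∑ i ∈ Finset.range (m + 1), Y i ω) ^ 2 =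
        (∑ i ∈ Finset.range m, Y i ω) ^ 2 + 2 * (∑ i ∈ Finset.range m, Y i ω * Y m ω) +
          Y m ω * Y (m + 0) ω := fun ω => by
      rw [Finset.sum_range_succ, ← Finset.sum_mul]
      simp only [add_zero]
      ring
    simp_rw [e]
    have hi2 : Integrable (fun ω => 2 * (∑ i ∈ Finset.range m, Y i ω * Y m ω)) P :=
      (integrable_finsetSum _ fun i _ => hi i m).const_mul 2
    have hi3 : Integrable (fun ω => (∑ i ∈ Finset.range m, Y i ω) ^ 2 +
        2 * (∑ i ∈ Finset.range m, Y i ω * Y m ω)) P := hS.integrable_sq.add hi2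
    rw [integral_add hi3 (hi m _), integral_add hS.integrable_sq hi2, integral_const_mul, integral_finsetSum _ fun i _ => hi i m]
    have h1 : ∑ i ∈ Finset.range m, ∫ ω, Y i ω * Y m ω ∂P ≤ c * (1 - p)⁻¹ := by
      calc ∑ i ∈ Finset.range m, ∫ ω, Y i ω * Y m ω ∂P
          ≤ ∑ i ∈ Finset.range m, c * p ^ (m - i) := by
            refine Finset.sum_le_sum fun i hi' => ?_
            have := h i (m - i)
            rwa [Nat.add_sub_cancel' (Finset.mem_range.1 hi').le] at this
        _ = c * ∑ i ∈ Finset.range m, p ^ (m - i) := by rw [Finset.mul_sum]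
        _ ≤ c * ∑ i ∈ Finset.range (m + 1), p ^ i := by
            refine mul_le_mul_of_nonneg_left ?_ hc
            -- Reflection produces the exponents m - i for i ≤ m; the surplus term i = m is
            -- nonnegative.
            rw [← Finset.sum_range_reflect (fun i => p ^ i) (m + 1), Finset.sum_range_succ]
            simp only [add_tsub_cancel_right]
            have : 0 ≤ p ^ (m - m) := by positivity
            linarith
        _ ≤ c * (1 - p)⁻¹ := by
            refine mul_le_mul_of_nonneg_left ?_ hc
            rw [← tsum_geometric_of_lt_one hp0 hp1]
            exact (summable_geometric_of_lt_one hp0 hp1).sum_le_tsum _ fun i _ => by positivity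
    have h2 := h m 0
    rw [pow_zero, mul_one] at h2
    push_cast
    linarith

/-- Second moments of order m make the squared averages at m = k² of order 1/k² in mean, which is
summable. Only squares are reached this way. -/
theorem ae_tendsto_sum_range_sq_div {Ω : Type*} [MeasurableSpace Ω] {P : Measure Ω}
    {Y : ℕ → Ω → ℝ} (hY : ∀ i, MemLp (Y i) 2 P) {c p : ℝ} (hp0 : 0 ≤ p) (hp1 : p < 1) 
    (hc : 0 ≤ c) (h : ∀ i k, ∫ ω, Y i ω * Y (i + k) ω ∂P ≤ c * p ^ k) :
    ∀ᵐ ω ∂P, Tendsto (fun k : ℕ => (∑ i ∈ Finset.range (k ^ 2), Y i ω) / ((k ^ 2 : ℕ) : ℝ))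
      atTop (𝓝 0) := by
  have hS : ∀ m, MemLp (fun ω => ∑ i ∈ Finset.range m, Y i ω) 2 P :=
    fun m => memLp_finsetSum _ fun i _ => hY i
  obtain ⟨C, hC⟩ : ∃ C, C = c + 2 * (c * (1 - p)⁻¹) := ⟨_, rfl⟩
  refine ae_tendsto_zero_of_integral_sq_le (b := fun k : ℕ => C * (1 / (k : ℝ) ^ 2))
    (fun k => ?_) ((Real.summable_one_div_nat_pow.2 one_lt_two).mul_left C) fun k => ?_
  · simp_rw [div_eq_inv_mul]
    exact (hS _).const_mul _
  · simp_rw [div_pow]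
    rw [integral_div]
    refine (div_le_div_of_nonneg_right (integral_sum_sq_le hY hp0 hp1 hc h _)
      (by positivity)).trans_eq ?_
    rcases Nat.eq_zero_or_pos k with rfl | hk
    · simp
    · have : (k : ℝ) ≠ 0 := by positivity
      push_cast
      rw [← hC]
      field_simp

/-- Consecutive squares have ratio tending to 1, so a monotone sequence cannot deviate between them.
-/
theorem tendsto_div_of_monotone_of_tendsto_sq {u : ℕ → ℝ} (hu : Monotone u) {l : ℝ}
    (h : Tendsto (fun k : ℕ => u (k ^ 2) / ((k ^ 2 : ℕ) : ℝ)) atTop (𝓝 l)) :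
    Tendsto (fun n : ℕ => u n / n) atTop (𝓝 l) := by
  refine tendsto_div_of_monotone_of_exists_subseq_tendsto_div u l hu fun a ha =>
    ⟨fun k => k ^ 2, ?_, tendsto_pow_atTop two_ne_zero, h⟩
  have h1 : Tendsto (fun n : ℕ => ((1 : ℝ) + 1 / (n : ℝ)) ^ 2) atTop (𝓝 1) := by
    simpa using (tendsto_const_nhds (x := (1 : ℝ))).add
      (tendsto_one_div_atTop_nhds_zero_nat (𝕜 := ℝ)) |>.pow 2
  filter_upwards [h1.eventually_le_const ha, eventually_gt_atTop 0] with n hn hn0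
  have hn' : (0 : ℝ) < n := by exact_mod_cast hn0
  have : (((n + 1) ^ 2 : ℕ) : ℝ) = (1 + 1 / (n : ℝ)) ^ 2 * ((n ^ 2 : ℕ) : ℝ) := by
    push_cast
    field_simp
  rw [this]
  gcongr

/-! ### Sojourn times of the queue -/

/-- Sojourn times in a single server queue with interarrival time `d`, service times `v` and
sojourn time `s` of customer `0`. -/
noncomputable def sojourn (d s : ℝ) (v : ℕ → ℝ) : ℕ → ℝ
  | 0 => s
  | k + 1 => max (sojourn d s v k - d) 0 + v k

theorem sojourn_nonneg {d s : ℝ} {v : ℕ → ℝ} (hs : 0 ≤ s) (hv : ∀ k, 0 ≤ v k) (k : ℕ) :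
    0 ≤ sojourn d s v k := by
  cases k with
  | zero => exact hs
  | succ k => exact add_nonneg (le_max_right _ _) (hv k)

theorem sojourn_mono {d s s' : ℝ} {v : ℕ → ℝ} (h : s ≤ s') (k : ℕ) :
    sojourn d s v k ≤ sojourn d s' v k := by
  induction k with
  | zero => exact h
  | succ k ih =>
    simp only [sojourn]
    gcongr

/-- Either some customer found the server idle, and from then on the initial state is forgotten, or
the server stayed busy and every step added v j - d. -/
theorem sojourn_le_max (d s : ℝ) (v : ℕ → ℝ) (k : ℕ) :
    sojourn d s v k ≤ max (sojourn d 0 v k) (s + ∑ j ∈ Finset.range k, (v j - d)) := by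
  induction k with
  | zero => simp [sojourn]
  | succ k ih =>
    simp only [sojourn, Finset.sum_range_succ]
    rcases le_max_iff.1 ih with h | h
    · refine le_max_of_le_left ?_
      gcongr
    · rcases le_total (sojourn d s v k) d with h' | h'
      · refine le_max_of_le_left ?_
        rw [max_eq_right (by linarith)]
        linarith [le_max_right (sojourn d 0 v k - d) 0]
      · refine le_max_of_le_right ?_
        rw [max_eq_left (by linarith)]
        linarith

theorem sojourn_add (d s : ℝ) (v : ℕ → ℝ) (i k : ℕ) :
    sojourn d s v (i + k) = sojourn d (sojourn d s v i) (fun n => v (i + n)) k := by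
  induction k with
  | zero => rfl
  | succ k ih => rw [← add_assoc, sojourn, ih, sojourn]

theorem measurable_sojourn {Ω : Type*} {m : MeasurableSpace Ω} (d : ℝ) {s : Ω → ℝ}
    {v : ℕ → Ω → ℝ} (hs : Measurable s) (k : ℕ) (hv : ∀ j < k, Measurable (v j)) :
    Measurable fun ω => sojourn d (s ω) (fun j => v j ω) k := by
  induction k with
  | zero => exact hs
  | succ k ih =>
    have := ih fun j hj => hv j (hj.trans k.lt_succ_self)
    have := hv k k.lt_succ_self
    simp only [sojourn]
    fun_prop

/-! ### Independence of functions of disjoint sets of coordinates -/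

/-- The `σ`-algebra generated by the variables `f i` with `i ∈ S`. -/
@[reducible] def coordSigma {Ω ι : Type*} (f : ι → Ω → ℝ) (S : Set ι) : MeasurableSpace Ω :=
  ⨆ i ∈ S, MeasurableSpace.comap (f i) inferInstance

theorem measurable_coordSigma {Ω ι : Type*} (f : ι → Ω → ℝ) {S : Set ι} {i : ι} (hi : i ∈ S) :
    Measurable[coordSigma f S] (f i) :=
  Measurable.of_comap_le (le_iSup₂_of_le i hi le_rfl)

/-- Reduces independence to recording which coordinates each variable uses. -/
theorem indepFun_of_coordSigma {Ω ι β γ : Type*} [MeasurableSpace Ω] [MeasurableSpace β]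
    [MeasurableSpace γ] {P : Measure Ω} {f : ι → Ω → ℝ} (hf : ∀ i, Measurable (f i))
    (h : iIndepFun f P) {S T : Set ι} (hST : Disjoint S T) {U : Ω → β} {W : Ω → γ}
    (hU : Measurable[coordSigma f S] U) (hW : Measurable[coordSigma f T] W) : IndepFun U W P := by
  rw [IndepFun_iff_Indep]
  have h1 : Indep (coordSigma f S) (coordSigma f T) P :=
    indep_iSup_of_disjoint (fun i => (hf i).comap_le) h hST
  exact indep_of_indep_of_le_left (indep_of_indep_of_le_right h1 hW.comap_le) hU.comap_le

/-! ### The stationary queue -/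

/-- `G 0` is a stationary initial sojourn time and `G 1, G 2, …` are service times of
the D/M/1 queue with interarrival time `d` and service rate `μ`. -/
structure IsStationaryQueue {Ω : Type*} [MeasurableSpace Ω] (P : Measure Ω) (d θ μ : ℝ)
    (G : ℕ → Ω → ℝ) : Prop where
  d_pos : 0 < d
  θ_pos : 0 < θ
  θ_lt : θ < μ
  exp_eq : Real.exp (-(θ * d)) = (μ - θ) / μ
  measurable : ∀ i, Measurable (G i)
  nonneg : ∀ i ω, 0 ≤ G i ω
  indep : iIndepFun G P
  law_zero : HasLaw (G 0) (expMeasure θ) P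
  law_succ : ∀ i, HasLaw (G (i + 1)) (expMeasure μ) P

namespace IsStationaryQueue

theorem measurable_sojourn_zero {Ω : Type*} {d : ℝ} {G : ℕ → Ω → ℝ} (i : ℕ) :
    Measurable[coordSigma G (Set.Iic i)]
      fun ω => sojourn d (G 0 ω) (fun k => G (k + 1) ω) i :=
  measurable_sojourn (v := fun k => G (k + 1)) d
    (measurable_coordSigma G (Set.mem_Iic.2 (Nat.zero_le i))) i
    fun _ hj => measurable_coordSigma G (Set.mem_Iic.2 hj)

/-- Here q is the exponential moment of V - d at η. Stability of the queue makes it less than 1 for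
small η, and η < θ keeps the exponential moment of the stationary sojourn time finite. -/
theorem exists_exponent {Ω : Type*} [MeasurableSpace Ω] {P : Measure Ω} {d θ μ : ℝ}
    {G : ℕ → Ω → ℝ} (h : IsStationaryQueue P d θ μ G) :
    ∃ η q : ℝ, 0 < η ∧ η < θ ∧ 0 ≤ q ∧ q < 1 ∧ q = Real.exp (-(η * d)) * (μ / (μ - η)) := by
  have hμ : 0 < μ := h.θ_pos.trans h.θ_lt
  have hd := h.d_pos
  have h1 : 1 < μ * d := by
    -- Stability follows from the equation for θ: 1 - θd < exp(-θd) = 1 - θ/μ.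
    have h2 := Real.add_one_lt_exp (x := -(θ * d)) (by nlinarith [mul_pos h.θ_pos hd])
    rw [h.exp_eq, sub_div, div_self hμ.ne'] at h2
    have h3 : θ / μ < θ * d := by linarith
    rw [div_lt_iff₀ hμ] at h3
    nlinarith [h.θ_pos]
  -- With exp(ηd) ≥ 1 + ηd, the inequality q < 1 reduces to (1 + ηd)(μ - η) > μ, that is η < μ -
  -- 1/d.
  obtain ⟨η, hη0, hη⟩ := exists_between (a₁ := 0) (a₂ := min θ (μ - 1 / d))
    (lt_min h.θ_pos (by rw [sub_pos, div_lt_iff₀ hd]; exact h1))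
  have hη1 := lt_of_lt_of_le hη (min_le_left _ _)
  have hη2 := lt_of_lt_of_le hη (min_le_right _ _)
  have hημ : 0 < μ - η := by linarith [h.θ_lt]
  refine ⟨η, _, hη0, hη1, by positivity, ?_, rfl⟩
  rw [← mul_div_assoc, div_lt_one hημ, Real.exp_neg, inv_mul_lt_iff₀ (Real.exp_pos _)]
  have h3 : η * d < μ * d - 1 := by
    have := mul_lt_mul_of_pos_right hη2 hd
    rwa [sub_mul, one_div, inv_mul_cancel₀ hd.ne'] at this
  have h4 := Real.add_one_le_exp (η * d)
  nlinarith

variable {Ω : Type*} [MeasurableSpace Ω] {P : Measure Ω} [IsProbabilityMeasure P] {d θ μ : ℝ}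
  {G : ℕ → Ω → ℝ}

theorem hasLaw_sojourn (h : IsStationaryQueue P d θ μ G) (i : ℕ) :
    HasLaw (fun ω => sojourn d (G 0 ω) (fun k => G (k + 1) ω) i) (expMeasure θ) P := by
  induction i with
  | zero => exact h.law_zero
  | succ i ih =>
    refine hasLaw_max_sub_add h.θ_pos h.d_pos h.θ_lt h.exp_eq
      (measurable_sojourn (v := fun k => G (k + 1)) d (h.measurable 0) i fun _ _ => h.measurable _)
      (h.measurable _) ih (h.law_succ i) ?_
    refine indepFun_of_coordSigma h.measurable h.indep (S := Set.Iic i) (T := {i + 1}) ?_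
      (measurable_sojourn_zero i) (measurable_coordSigma G rfl)
    simp

theorem memLp_sojourn (h : IsStationaryQueue P d θ μ G) (i : ℕ) :
    MemLp (fun ω => sojourn d (G 0 ω) (fun k => G (k + 1) ω) i) 2 P := by
  have h1 := h.hasLaw_sojourn i
  have h2 := memLp_two_expMeasure h.θ_pos
  rw [← h1.map_eq] at h2
  exact (memLp_map_measure_iff (by fun_prop) h1.aemeasurable).1 h2

theorem integral_sojourn (h : IsStationaryQueue P d θ μ G) (i : ℕ) :
    ∫ ω, sojourn d (G 0 ω) (fun k => G (k + 1) ω) i ∂P = 1 / θ := by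
  rw [← integral_id_expMeasure h.θ_pos, ← (h.hasLaw_sojourn i).integral_eq]

/-- The stationary sojourn time of customer i contributes θ/(θ - η), and each later independent
increment V - d contributes a factor q. -/
theorem lintegral_exp_excess (h : IsStationaryQueue P d θ μ G) {η q : ℝ} (hηθ : η < θ)
    (hq : q = Real.exp (-(η * d)) * (μ / (μ - η))) (i k : ℕ) :
    ∫⁻ ω, ENNReal.ofReal (Real.exp (η * (sojourn d (G 0 ω) (fun k => G (k + 1) ω) i +
      ∑ j ∈ Finset.range k, (G (i + j + 1) ω - d)))) ∂P = ENNReal.ofReal (θ / (θ - η) * q ^ k) := by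
  have hμ : 0 < μ := h.θ_pos.trans h.θ_lt
  have hημ : 0 < μ - η := by linarith [h.θ_lt]
  have hηθ' : 0 < θ - η := by linarith
  have hS : ∀ j, Measurable[coordSigma G (Set.Iic (i + j))] fun ω =>
      sojourn d (G 0 ω) (fun k => G (k + 1) ω) i + ∑ j ∈ Finset.range j, (G (i + j + 1) ω - d) := by
    intro j
    have h1 : Measurable[coordSigma G (Set.Iic (i + j))]
        fun ω => sojourn d (G 0 ω) (fun k => G (k + 1) ω) i :=
      measurable_sojourn (v := fun k => G (k + 1)) d
        (measurable_coordSigma G (Set.mem_Iic.2 (Nat.zero_le _))) i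
        fun l hl => measurable_coordSigma G (Set.mem_Iic.2 (by omega))
    refine h1.add (Finset.measurable_fun_sum _ fun l hl => ?_)
    exact (measurable_coordSigma G (Set.mem_Iic.2
      (by have := Finset.mem_range.1 hl; omega))).sub_const d
  induction k with
  | zero =>
    have h1 := (h.hasLaw_sojourn i).lintegral_comp
      (f := fun x => ENNReal.ofReal (Real.exp (η * x))) (by fun_prop)
    simp only [Finset.range_zero, Finset.sum_empty, add_zero, pow_zero, mul_one]
    rw [h1, lintegral_exp_mul_expMeasure h.θ_pos hηθ]
  | succ k ih =>
    have h1 : IndepFun (fun ω => ENNReal.ofReal (Real.exp (η *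
        (sojourn d (G 0 ω) (fun k => G (k + 1) ω) i +
          ∑ j ∈ Finset.range k, (G (i + j + 1) ω - d)))))
        (fun ω => ENNReal.ofReal (Real.exp (η * G (i + k + 1) ω))) P := by
      have h2 : IndepFun (fun ω => sojourn d (G 0 ω) (fun k => G (k + 1) ω) i +
          ∑ j ∈ Finset.range k, (G (i + j + 1) ω - d)) (G (i + k + 1)) P :=
        indepFun_of_coordSigma h.measurable h.indep (S := Set.Iic (i + k)) (T := {i + k + 1})
          (by simp) (hS k) (measurable_coordSigma G rfl)
      exact h2.comp (φ := fun x => ENNReal.ofReal (Real.exp (η * x)))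
        (ψ := fun x => ENNReal.ofReal (Real.exp (η * x))) (by fun_prop) (by fun_prop)
    have h3 : ∀ ω, ENNReal.ofReal (Real.exp (η * (sojourn d (G 0 ω) (fun k => G (k + 1) ω) i +
        ∑ j ∈ Finset.range (k + 1), (G (i + j + 1) ω - d)))) =
        ENNReal.ofReal (Real.exp (-(η * d))) * (ENNReal.ofReal (Real.exp (η *
          (sojourn d (G 0 ω) (fun k => G (k + 1) ω) i +
            ∑ j ∈ Finset.range k, (G (i + j + 1) ω - d)))) *
        ENNReal.ofReal (Real.exp (η * G (i + k + 1) ω))) := fun ω => by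
      rw [← ENNReal.ofReal_mul (Real.exp_pos _).le, ← ENNReal.ofReal_mul (Real.exp_pos _).le,
        ← Real.exp_add, ← Real.exp_add, Finset.sum_range_succ]
      congr 2
      ring
    have hGm := h.measurable (i + k + 1)
    have hSm : Measurable fun ω => sojourn d (G 0 ω) (fun k => G (k + 1) ω) i +
        ∑ j ∈ Finset.range k, (G (i + j + 1) ω - d) :=
      (hS k).mono (iSup₂_le fun j _ => (h.measurable j).comap_le) le_rfl
    have h4 := (h.law_succ (i + k)).lintegral_comp
      (f := fun x => ENNReal.ofReal (Real.exp (η * x))) (by fun_prop)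
    rw [lintegral_congr h3, lintegral_const_mul' _ _ ENNReal.ofReal_ne_top,
      lintegral_mul_eq_lintegral_mul_lintegral_of_indepFun''
        (hSm.const_mul η).exp.ennreal_ofReal.aemeasurable (by fun_prop) h1, ih, h4,
      lintegral_exp_mul_expMeasure hμ (by linarith), hq, ← ENNReal.ofReal_mul' (by positivity),
      ← ENNReal.ofReal_mul (by positivity)]
    congr 1
    ring

/-- Coupling: forgetting the sojourn time of customer `i` changes that of customer `i + k` by an
amount that is geometrically small in `k`. -/
theorem integral_coupling_le (h : IsStationaryQueue P d θ μ G) {η q : ℝ} (hη0 : 0 < η)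
    (hηθ : η < θ) (hq0 : 0 ≤ q) (hq : q = Real.exp (-(η * d)) * (μ / (μ - η))) (i k : ℕ) :
    MemLp (fun ω => sojourn d 0 (fun j => G (i + j + 1) ω) k) 2 P ∧
    MemLp (fun ω => sojourn d (G 0 ω) (fun k => G (k + 1) ω) (i + k) -
      sojourn d 0 (fun j => G (i + j + 1) ω) k) 2 P ∧
    ∫ ω, (sojourn d (G 0 ω) (fun k => G (k + 1) ω) (i + k) -
      sojourn d 0 (fun j => G (i + j + 1) ω) k) ^ 2 ∂P ≤ 2 / η ^ 2 * (θ / (θ - η)) * q ^ k := by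
  have hηθ' : 0 < θ - η := by linarith
  have hθ := h.θ_pos
  have hnn : ∀ ω i, 0 ≤ sojourn d (G 0 ω) (fun k => G (k + 1) ω) i := fun ω i =>
    sojourn_nonneg (h.nonneg 0 ω) (fun k => h.nonneg _ ω) i
  have hRnn : ∀ ω, 0 ≤ sojourn d 0 (fun j => G (i + j + 1) ω) k := fun ω =>
    sojourn_nonneg le_rfl (fun k => h.nonneg _ ω) k
  have hadd : ∀ ω, sojourn d (G 0 ω) (fun k => G (k + 1) ω) (i + k) =
      sojourn d (sojourn d (G 0 ω) (fun k => G (k + 1) ω) i) (fun j => G (i + j + 1) ω) k :=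
    fun ω => sojourn_add _ _ _ _ _
  have hle : ∀ ω, sojourn d 0 (fun j => G (i + j + 1) ω) k ≤
      sojourn d (G 0 ω) (fun k => G (k + 1) ω) (i + k) := fun ω => by
    rw [hadd]
    exact sojourn_mono (hnn ω i) k
  have hRm : Measurable fun ω => sojourn d 0 (fun j => G (i + j + 1) ω) k :=
    measurable_sojourn (v := fun j => G (i + j + 1)) d measurable_const k fun _ _ => h.measurable _
  have hR : MemLp (fun ω => sojourn d 0 (fun j => G (i + j + 1) ω) k) 2 P :=
    (h.memLp_sojourn (i + k)).mono hRm.aestronglyMeasurable (ae_of_all _ fun ω => by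
      rw [Real.norm_of_nonneg (hRnn ω), Real.norm_of_nonneg (hnn ω _)]
      exact hle ω)
  have hδ : MemLp (fun ω => sojourn d (G 0 ω) (fun k => G (k + 1) ω) (i + k) -
      sojourn d 0 (fun j => G (i + j + 1) ω) k) 2 P := (h.memLp_sojourn (i + k)).sub hR
  refine ⟨hR, hδ, ?_⟩
  rw [integral_eq_lintegral_of_nonneg_ae (ae_of_all _ fun ω => sq_nonneg _)
    hδ.integrable_sq.aestronglyMeasurable]
  refine ENNReal.toReal_le_of_le_ofReal (by positivity) ?_
  have hb : ∀ ω, ENNReal.ofReal ((sojourn d (G 0 ω) (fun k => G (k + 1) ω) (i + k) -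
      sojourn d 0 (fun j => G (i + j + 1) ω) k) ^ 2) ≤ ENNReal.ofReal (2 / η ^ 2) *
      ENNReal.ofReal (Real.exp (η * (sojourn d (G 0 ω) (fun k => G (k + 1) ω) i +
        ∑ j ∈ Finset.range k, (G (i + j + 1) ω - d)))) := fun ω => by
    rw [← ENNReal.ofReal_mul (by positivity)]
    refine ENNReal.ofReal_le_ofReal ?_
    have h1 := sojourn_le_max d (sojourn d (G 0 ω) (fun k => G (k + 1) ω) i)
      (fun j => G (i + j + 1) ω) k
    rw [← hadd ω] at h1
    have h2 := hle ω
    set A := sojourn d (G 0 ω) (fun k => G (k + 1) ω) i +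
        ∑ j ∈ Finset.range k, (G (i + j + 1) ω - d)
    set S := sojourn d (G 0 ω) (fun k => G (k + 1) ω) (i + k)
    set R := sojourn d 0 (fun j => G (i + j + 1) ω) k
    have hR0 : 0 ≤ R := hRnn ω
    -- Either the two queues have merged, or the server has been busy since customer i and 0 ≤ S - R
    -- ≤ A. In the second case x²/2 ≤ exp x at x = ηA gives the factor 2/η².
    rcases le_max_iff.1 h1 with h3 | h3
    · have : S - R = 0 := by linarith
      rw [this, zero_pow two_ne_zero]
      positivity
    · have h4 : 0 ≤ S - R := by linarith
      have h5 : S - R ≤ A := by linarith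
      have h6 := Real.quadratic_le_exp_of_nonneg (x := η * A) (by nlinarith)
      have h7 : (S - R) ^ 2 ≤ A ^ 2 := pow_le_pow_left₀ h4 h5 2
      have h8 : 0 ≤ η * A := by nlinarith
      rw [div_mul_eq_mul_div, le_div_iff₀ (by positivity)]
      nlinarith [sq_nonneg η]
  refine (lintegral_mono hb).trans_eq ?_
  rw [lintegral_const_mul' _ _ ENNReal.ofReal_ne_top, h.lintegral_exp_excess hηθ hq i k,
    ← ENNReal.ofReal_mul (by positivity)]
  congr 1
  ring

/-- In the stationary queue, customer i is independent of the queue restarted empty at i. The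
covariance with customer i + k therefore only sees the coupling error, and it decays geometrically.
-/
theorem ae_tendsto_sojourn_average_aux (h : IsStationaryQueue P d θ μ G) :
    ∀ᵐ ω ∂P, Tendsto (fun n : ℕ => (∑ i ∈ Finset.range n,
      sojourn d (G 0 ω) (fun k => G (k + 1) ω) i) / n) atTop (𝓝 (1 / θ)) := by
  obtain ⟨η, q, hη0, hηθ, hq0, hq1, hq⟩ := h.exists_exponent
  have hθ := h.θ_pos
  have hηθ' : 0 < θ - η := by linarith
  set Y : ℕ → Ω → ℝ := fun i ω => sojourn d (G 0 ω) (fun k => G (k + 1) ω) i - 1 / θ with hYdef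
  have hY : ∀ i, MemLp (Y i) 2 P := fun i => (h.memLp_sojourn i).sub (memLp_const _)
  have hY0 : ∀ i, ∫ ω, Y i ω ∂P = 0 := fun i => by
    rw [hYdef]
    simp only
    rw [integral_sub ((h.memLp_sojourn i).integrable one_le_two) (integrable_const _),
      h.integral_sojourn]
    simp
  set c1 := ∫ x, (x - 1 / θ) ^ 2 ∂(expMeasure θ) with hc1
  have hvar : ∀ i, ∫ ω, Y i ω ^ 2 ∂P = c1 := fun i =>
    (h.hasLaw_sojourn i).integral_comp (f := fun x => (x - 1 / θ) ^ 2) (by fun_prop)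
  have hc1nn : 0 ≤ c1 := integral_nonneg fun x => sq_nonneg _
  set B := 2 / η ^ 2 * (θ / (θ - η)) with hB
  have hB0 : 0 ≤ B := by positivity
  -- The coupling error has second moment of order q ^ k, hence L² norm of order p ^ k.
  set p := Real.sqrt q with hp
  have hp0 : 0 ≤ p := Real.sqrt_nonneg q
  have hpq : p ^ 2 = q := Real.sq_sqrt hq0
  have hp1 : p < 1 := by nlinarith
  have hqpos : 0 < q := by
    rw [hq]
    have : 0 < μ - η := by linarith [h.θ_lt]
    have : 0 < μ := hθ.trans h.θ_lt
    positivity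
  have hppos : 0 < p := Real.sqrt_pos.2 hqpos
  have hcorr : ∀ i k, ∫ ω, Y i ω * Y (i + k) ω ∂P ≤ (c1 + B) / 2 * p ^ k := by
    intro i k
    obtain ⟨hR, hδ, hδle⟩ := h.integral_coupling_le hη0 hηθ hq0 hq i k
    have hind : IndepFun (Y i) (fun ω => sojourn d 0 (fun j => G (i + j + 1) ω) k - 1 / θ) P := by
      refine indepFun_of_coordSigma h.measurable h.indep (S := Set.Iic i) (T := Set.Ioi i)
        (Set.Iic_disjoint_Ioi le_rfl) ((measurable_sojourn_zero i).sub_const _) ?_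
      exact (measurable_sojourn (v := fun j => G (i + j + 1)) d measurable_const k fun j _ =>
        measurable_coordSigma G (Set.mem_Ioi.2 (by omega))).sub_const _
    have hR' : MemLp (fun ω => sojourn d 0 (fun j => G (i + j + 1) ω) k - 1 / θ) 2 P :=
      hR.sub (memLp_const _)
    have e : ∀ ω, Y i ω * Y (i + k) ω = Y i ω * (sojourn d (G 0 ω) (fun k => G (k + 1) ω) (i + k) -
        sojourn d 0 (fun j => G (i + j + 1) ω) k) +
        Y i ω * (sojourn d 0 (fun j => G (i + j + 1) ω) k - 1 / θ) := fun ω => by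
      simp only [hYdef]; ring
    have hi1 : Integrable (fun ω => Y i ω * (sojourn d (G 0 ω) (fun k => G (k + 1) ω) (i + k) -
        sojourn d 0 (fun j => G (i + j + 1) ω) k)) P := (hY i).integrable_mul hδ
    have hi2 : Integrable (fun ω => Y i ω *
        (sojourn d 0 (fun j => G (i + j + 1) ω) k - 1 / θ)) P := (hY i).integrable_mul hR'
    rw [integral_congr_ae (ae_of_all _ e), integral_add hi1 hi2,
      hind.integral_fun_mul_eq_mul_integral (hY i).1 hR'.1, hY0 i, zero_mul, add_zero]
    -- Weighted arithmetic-geometric mean inequality in place of Cauchy–Schwarz; the weight p ^ k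
    -- balances the two terms.
    calc _ ≤ ∫ ω, (p ^ k / 2 * Y i ω ^ 2 + (p ^ k)⁻¹ / 2 *
          (sojourn d (G 0 ω) (fun k => G (k + 1) ω) (i + k) -
            sojourn d 0 (fun j => G (i + j + 1) ω) k) ^ 2) ∂P := by
          refine integral_mono hi1 (((hY i).integrable_sq.const_mul _).add
            (hδ.integrable_sq.const_mul _)) fun ω => ?_
          simp only
          set a := Y i ω
          set b := sojourn d (G 0 ω) (fun k => G (k + 1) ω) (i + k) -
            sojourn d 0 (fun j => G (i + j + 1) ω) k
          have hpk : 0 < p ^ k := pow_pos hppos k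
          have h1 : 0 ≤ (p ^ k)⁻¹ / 2 * (p ^ k * a - b) ^ 2 := by positivity
          have h2 : (p ^ k)⁻¹ / 2 * (p ^ k * a - b) ^ 2 =
              p ^ k / 2 * a ^ 2 + (p ^ k)⁻¹ / 2 * b ^ 2 - a * b := by
            field_simp
            ring
          linarith
      _ = p ^ k / 2 * c1 + (p ^ k)⁻¹ / 2 * ∫ ω, (sojourn d (G 0 ω) (fun k => G (k + 1) ω) (i + k) -
            sojourn d 0 (fun j => G (i + j + 1) ω) k) ^ 2 ∂P := by
          rw [integral_add ((hY i).integrable_sq.const_mul _) (hδ.integrable_sq.const_mul _),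
            integral_const_mul, integral_const_mul, hvar]
      _ ≤ p ^ k / 2 * c1 + (p ^ k)⁻¹ / 2 * (B * q ^ k) := by gcongr
      _ = (c1 + B) / 2 * p ^ k := by
          rw [← hpq]
          have hpk : 0 < p ^ k := pow_pos hppos k
          field_simp
          ring
  filter_upwards [ae_tendsto_sum_range_sq_div hY hp0 hp1 (by positivity) hcorr] with ω hω
  refine tendsto_div_of_monotone_of_tendsto_sq
    (u := fun n => ∑ i ∈ Finset.range n, sojourn d (G 0 ω) (fun k => G (k + 1) ω) i) ?_ ?_
  · refine monotone_nat_of_le_succ fun n => ?_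
    rw [Finset.sum_range_succ]
    linarith [sojourn_nonneg (d := d) (h.nonneg 0 ω) (fun k => h.nonneg (k + 1) ω) n]
  · have h2 := hω.add_const (1 / θ)
    rw [zero_add] at h2
    refine h2.congr' ?_
    filter_upwards [eventually_gt_atTop 0] with k hk
    have hk' : (k : ℝ) ≠ 0 := by positivity
    simp only [hYdef, Finset.sum_sub_distrib, Finset.sum_const, Finset.card_range, nsmul_eq_mul]
    push_cast
    field_simp
    ring

/-- Long-run average of the sojourn times in the queue that starts empty. -/
theorem ae_tendsto_sojourn_average (h : IsStationaryQueue P d θ μ G) :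
    ∀ᵐ ω ∂P, Tendsto (fun n : ℕ => (∑ i ∈ Finset.range n,
      sojourn d 0 (fun k => G (k + 1) ω) i) / n) atTop (𝓝 (1 / θ)) := by
  obtain ⟨η, q, hη0, hηθ, hq0, hq1, hq⟩ := h.exists_exponent
  -- Coupling at customer 0: the second moments of the difference between stationary and empty start
  -- are summable, so the difference vanishes almost surely, and then in Cesàro mean.
  have h1 : ∀ᵐ ω ∂P, Tendsto (fun n : ℕ => sojourn d (G 0 ω) (fun k => G (k + 1) ω) (0 + n) -
      sojourn d 0 (fun j => G (0 + j + 1) ω) n) atTop (𝓝 0) :=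
    ae_tendsto_zero_of_integral_sq_le
      (fun n => (h.integral_coupling_le hη0 hηθ hq0 hq 0 n).2.1)
      ((summable_geometric_of_lt_one hq0 hq1).mul_left _)
      (fun n => (h.integral_coupling_le hη0 hηθ hq0 hq 0 n).2.2)
  filter_upwards [h1, h.ae_tendsto_sojourn_average_aux] with ω hω1 hω2
  have h3 := hω2.sub hω1.cesaro
  rw [sub_zero] at h3
  refine h3.congr fun n => ?_
  simp only [zero_add, Finset.sum_sub_distrib]
  ring

/-- The queue that starts empty is dominated by the stationary one. -/
theorem exists_integral_sojourn_sq_le (h : IsStationaryQueue P d θ μ G) :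
    ∃ K, 0 ≤ K ∧ ∀ k, ∫⁻ ω, ENNReal.ofReal (sojourn d 0 (fun k => G (k + 1) ω) k ^ 2) ∂P ≤
      ENNReal.ofReal K := by
  refine ⟨∫ x, x ^ 2 ∂(expMeasure θ), integral_nonneg fun x => sq_nonneg _, fun k => ?_⟩
  rw [ofReal_integral_eq_lintegral_ofReal (memLp_two_expMeasure h.θ_pos).integrable_sq
    (ae_of_all _ fun x => sq_nonneg _), ← (h.hasLaw_sojourn k).lintegral_comp
      (f := fun x => ENNReal.ofReal (x ^ 2)) (by fun_prop)]
  refine lintegral_mono fun ω => ENNReal.ofReal_le_ofReal ?_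
  exact pow_le_pow_left₀ (sojourn_nonneg le_rfl (fun k => h.nonneg _ ω) k)
    (sojourn_mono (h.nonneg 0 ω) k) 2

end IsStationaryQueue

/-! ### Inverting sequences of linear growth -/

theorem tendsto_atTop_of_tendsto_div {u : ℕ → ℝ} {a : ℝ} (ha : 0 < a)
    (hu : Tendsto (fun n : ℕ => u n / n) atTop (𝓝 a)) : Tendsto u atTop atTop := by
  have h := hu.pos_mul_atTop ha (tendsto_natCast_atTop_atTop (R := ℝ))
  refine h.congr' ?_
  filter_upwards [eventually_gt_atTop 0] with n hn
  have : (n : ℝ) ≠ 0 := by positivity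
  field_simp

/-- Without monotonicity this is some crossing of the level T, which is all that the renewal
argument needs. -/
theorem exists_index_of_tendsto_atTop {u : ℕ → ℝ} (hu : Tendsto u atTop atTop) :
    ∃ N : ℝ → ℕ, ∀ T, u 0 ≤ T → u (N T) ≤ T ∧ T < u (N T + 1) := by
  have h : ∀ T, ∃ n, u 0 ≤ T → u n ≤ T ∧ T < u (n + 1) := by
    intro T
    by_contra! hcon
    have h0 : u 0 ≤ T := (hcon 0).1
    have h1 : ∀ n, u n ≤ T := fun n => by
      induction n with
      | zero => exact h0
      | succ n ih => exact (hcon n).2 ih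
    obtain ⟨n, hn⟩ := (hu.eventually_gt_atTop T).exists
    exact absurd (h1 n) (not_le.2 hn)
  choose N hN using h
  exact ⟨N, hN⟩

theorem tendsto_succ_div {Y : ℕ → ℝ} {c : ℝ}
    (hY : Tendsto (fun n : ℕ => Y n / n) atTop (𝓝 c)) :
    Tendsto (fun n : ℕ => Y (n + 1) / n) atTop (𝓝 c) := by
  have h1 : Tendsto (fun n : ℕ => (1 : ℝ) + 1 / (n : ℝ)) atTop (𝓝 1) := by
    simpa using (tendsto_const_nhds (x := (1 : ℝ))).add
      (tendsto_one_div_atTop_nhds_zero_nat (𝕜 := ℝ))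
  have h2 := (hY.comp (tendsto_add_atTop_nat 1)).mul h1
  rw [mul_one] at h2
  refine h2.congr' ?_
  filter_upwards [eventually_gt_atTop 0] with n hn
  have : (n : ℝ) ≠ 0 := by positivity
  have : (n : ℝ) + 1 ≠ 0 := by positivity
  simp only [Function.comp]
  push_cast
  field_simp

/-- Renewal argument: T lies between u (N T) and u (N T + 1), so T / N T tends to a. -/
theorem tendsto_comp_index_div {u Y : ℕ → ℝ} {a c : ℝ} (ha : 0 < a)
    (hu : Tendsto (fun n : ℕ => u n / n) atTop (𝓝 a))
    (hY : Tendsto (fun n : ℕ => Y n / n) atTop (𝓝 c)) {N : ℝ → ℕ}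
    (hN : ∀ T, u 0 ≤ T → u (N T) ≤ T ∧ T < u (N T + 1)) :
    Tendsto (fun T => Y (N T) / T) atTop (𝓝 (c / a)) := by
  have hNtop : Tendsto N atTop atTop := by
    refine tendsto_atTop.2 fun K => ?_
    -- Once T exceeds u 0, …, u K, a crossing of T cannot have index below K.
    have : ∀ᶠ T : ℝ in atTop, ∀ n ∈ Finset.range (K + 1), u n ≤ T := by
      rw [Filter.eventually_all_finset]
      exact fun n _ => eventually_ge_atTop _
    filter_upwards [this, eventually_ge_atTop (u 0)] with T hT hT0
    by_contra! hlt
    exact absurd (hN T hT0).2 (not_lt.2 (hT (N T + 1) (Finset.mem_range.2 (by omega))))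
  have h1 := tendsto_succ_div hu
  have hTN : Tendsto (fun T => T / (N T : ℝ)) atTop (𝓝 a) := by
    refine tendsto_of_tendsto_of_tendsto_of_le_of_le' (hu.comp hNtop) (h1.comp hNtop) ?_ ?_
    · filter_upwards [eventually_ge_atTop (u 0)] with T hT
      exact div_le_div_of_nonneg_right (hN T hT).1 (by positivity)
    · filter_upwards [eventually_ge_atTop (u 0)] with T hT
      exact div_le_div_of_nonneg_right (hN T hT).2.le (by positivity)
  refine ((hY.comp hNtop).div hTN ha.ne').congr' ?_
  filter_upwards [hNtop.eventually_gt_atTop 0, eventually_gt_atTop 0] with T hT hT0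
  have : (N T : ℝ) ≠ 0 := by positivity
  simp only [Function.comp, Pi.div_apply]
  field_simp

theorem tendsto_div_atTop_of_monotone {F : ℝ → ℝ} {d c : ℝ} (hd : 0 < d) 
    (hF : MonotoneOn F (Set.Ici 0)) 
    (h : Tendsto (fun n : ℕ => F (n * d) / n) atTop (𝓝 c)) :
    Tendsto (fun T => F T / T) atTop (𝓝 (c / d)) := by
  have hu : Tendsto (fun n : ℕ => ((n : ℝ) * d) / n) atTop (𝓝 d) := by
    refine tendsto_const_nhds.congr' ?_
    filter_upwards [eventually_gt_atTop 0] with n hn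
    have : (n : ℝ) ≠ 0 := by positivity
    field_simp
  obtain ⟨N, hN⟩ := exists_index_of_tendsto_atTop (tendsto_atTop_of_tendsto_div hd hu)
  refine tendsto_of_tendsto_of_tendsto_of_le_of_le' (tendsto_comp_index_div hd hu h hN)
    (tendsto_comp_index_div (Y := fun n => F ((n + 1 : ℕ) * d)) hd hu
      (tendsto_succ_div (Y := fun n : ℕ => F (n * d)) h) hN) ?_ ?_
  · filter_upwards [eventually_gt_atTop 0] with T hT
    have := hN T (by simpa using hT.le)
    exact div_le_div_of_nonneg_right
      (hF (Set.mem_Ici.2 (by positivity)) (Set.mem_Ici.2 hT.le) this.1) hT.le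
  · filter_upwards [eventually_gt_atTop 0] with T hT
    have := hN T (by simpa using hT.le)
    exact div_le_div_of_nonneg_right
      (hF (Set.mem_Ici.2 hT.le) (Set.mem_Ici.2 (by positivity)) this.2.le) hT.le

/-! ### The delay of an event -/

/-- Time between an event at time `s` and the delivery of the first sample that counts it. -/
noncomputable def eventDelay (d : ℝ) (v : ℕ → ℝ) (s : ℝ) : ℝ :=
  sojourn d 0 v ⌈s / d⌉₊ + (⌈s / d⌉₊ * d - s)

theorem measurable_eventDelay (d : ℝ) :
    Measurable fun p : (ℕ → ℝ) × ℝ => eventDelay d p.1 p.2 := by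
  have h1 : Measurable fun q : ℕ × (ℕ → ℝ) => sojourn d 0 q.2 q.1 :=
    measurable_from_prod_countable_right fun k =>
      measurable_sojourn (v := fun (j : ℕ) (v : ℕ → ℝ) => v j) d measurable_const k
        fun j _ => measurable_pi_apply j
  have h2 : Measurable fun p : (ℕ → ℝ) × ℝ => ⌈p.2 / d⌉₊ :=
    Nat.measurable_ceil.comp (measurable_snd.div_const d)
  have h3 : Measurable fun p : (ℕ → ℝ) × ℝ => ((⌈p.2 / d⌉₊ : ℕ) : ℝ) :=
    measurable_from_top.comp h2
  exact (h1.comp (h2.prodMk measurable_fst)).add ((h3.mul_const d).sub measurable_snd)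

theorem le_ceil_div_mul {d : ℝ} (hd : 0 < d) (s : ℝ) : s ≤ ⌈s / d⌉₊ * d :=
  (div_le_iff₀ hd).1 (Nat.le_ceil _)

theorem eventDelay_nonneg {d : ℝ} (hd : 0 < d) {v : ℕ → ℝ} (hv : ∀ k, 0 ≤ v k) (s : ℝ) :
    0 ≤ eventDelay d v s :=
  add_nonneg (sojourn_nonneg le_rfl hv _) (sub_nonneg.2 (le_ceil_div_mul hd s))

theorem exists_eventDelay_le {d : ℝ} (hd : 0 < d) {v : ℕ → ℝ} (hv : ∀ k, 0 ≤ v k) (x y : ℝ) :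
    ∃ B, ∀ s, x ≤ s → s ≤ y → eventDelay d v s ≤ B := by
  refine ⟨∑ k ∈ Finset.range (⌈y / d⌉₊ + 1), sojourn d 0 v k + (⌈y / d⌉₊ * d - x),
    fun s hxs hsy => ?_⟩
  have h1 : ⌈s / d⌉₊ ≤ ⌈y / d⌉₊ := Nat.ceil_mono (by gcongr)
  refine add_le_add ?_ ?_
  · exact Finset.single_le_sum (f := fun k => sojourn d 0 v k)
      (fun k _ => sojourn_nonneg le_rfl hv k) (Finset.mem_range.2 (by omega))
  · gcongr

theorem intervalIntegrable_eventDelay_pow {d : ℝ} (hd : 0 < d) {v : ℕ → ℝ} (hv : ∀ k, 0 ≤ v k)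
    (n : ℕ) (a x y : ℝ) :
    IntervalIntegrable (fun u => eventDelay d v (a + u) ^ n) volume x y := by
  obtain ⟨B, hB⟩ := exists_eventDelay_le hd hv (a + min x y) (a + max x y)
  have hm : Measurable fun u => eventDelay d v (a + u) ^ n :=
    ((measurable_eventDelay d).comp (measurable_const.prodMk (measurable_const_add a))).pow_const n
  rw [intervalIntegrable_iff]
  refine Measure.integrableOn_of_bounded (M := B ^ n) (by simp) hm.aestronglyMeasurable ?_
  refine (ae_restrict_iff' measurableSet_uIoc).2 (ae_of_all _ fun u hu => ?_)
  have h1 : min x y ≤ u := hu.1.le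
  have h2 : u ≤ max x y := hu.2
  have h0 := eventDelay_nonneg hd hv (a + u)
  rw [Real.norm_of_nonneg (pow_nonneg h0 n)]
  exact pow_le_pow_left₀ h0 (hB _ (by linarith) (by linarith)) n

theorem intervalIntegrable_eventDelay {d : ℝ} (hd : 0 < d) {v : ℕ → ℝ} (hv : ∀ k, 0 ≤ v k)
    (a x y : ℝ) : IntervalIntegrable (fun u => eventDelay d v (a + u)) volume x y := by
  simpa using intervalIntegrable_eventDelay_pow hd hv 1 a x y

/-- Every time in (kd, (k + 1)d] waits for sample k + 1; the wait until sampling integrates to d²/2.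
-/
theorem integral_eventDelay_block {d : ℝ} (hd : 0 < d) (v : ℕ → ℝ) (k : ℕ) :
    ∫ s in (k * d : ℝ)..((k + 1 : ℕ) * d), eventDelay d v s =
      d * sojourn d 0 v (k + 1) + d ^ 2 / 2 := by
  have hle : (k * d : ℝ) ≤ ((k + 1 : ℕ) * d) := by push_cast; nlinarith
  have h1 : ∫ s in (k * d : ℝ)..((k + 1 : ℕ) * d), eventDelay d v s =
      ∫ s in (k * d : ℝ)..((k + 1 : ℕ) * d), (sojourn d 0 v (k + 1) + ((k + 1 : ℕ) * d - s)) := by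
    rw [intervalIntegral.integral_of_le hle, intervalIntegral.integral_of_le hle]
    refine setIntegral_congr_fun measurableSet_Ioc fun s hs => ?_
    have h2 : ⌈s / d⌉₊ = k + 1 := by
      rw [Nat.ceil_eq_iff (by omega)]
      refine ⟨?_, (div_le_iff₀ hd).2 hs.2⟩
      rw [lt_div_iff₀ hd]
      simpa using hs.1
    simp only [eventDelay, h2]
  rw [h1, intervalIntegral.integral_add (by simp) (by apply Continuous.intervalIntegrable; fun_prop),
    intervalIntegral.integral_sub (by simp) (by apply Continuous.intervalIntegrable; fun_prop)]
  simp only [intervalIntegral.integral_const, smul_eq_mul, integral_id]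
  push_cast
  ring

/-- The term k = 0 of the sum vanishes because the queue starts empty. -/
theorem integral_eventDelay {d : ℝ} (hd : 0 < d) {v : ℕ → ℝ} (hv : ∀ k, 0 ≤ v k) (m : ℕ) :
    ∫ s in (0 : ℝ)..(m * d), eventDelay d v s =
      d * (∑ k ∈ Finset.range (m + 1), sojourn d 0 v k) + m * (d ^ 2 / 2) := by
  induction m with
  | zero => simp [sojourn]
  | succ m ih =>
    have hi : ∀ x y, IntervalIntegrable (eventDelay d v) volume x y := fun x y => by
      simpa using intervalIntegrable_eventDelay hd hv 0 x y
    rw [← intervalIntegral.integral_add_adjacent_intervals (hi _ (m * d)) (hi _ _), ih,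
      integral_eventDelay_block hd, Finset.sum_range_succ _ (m + 1)]
    push_cast
    ring

theorem tendsto_integral_eventDelay_div {d : ℝ} (hd : 0 < d) {v : ℕ → ℝ} (hv : ∀ k, 0 ≤ v k)
    {c : ℝ}
    (h : Tendsto (fun n : ℕ => (∑ k ∈ Finset.range n, sojourn d 0 v k) / n) atTop (𝓝 c)) :
    Tendsto (fun T => (∫ s in (0 : ℝ)..T, eventDelay d v s) / T) atTop (𝓝 (c + d / 2)) := by
  have hi : ∀ x y, IntervalIntegrable (eventDelay d v) volume x y := fun x y => by
    simpa using intervalIntegrable_eventDelay hd hv 0 x y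
  have e : c + d / 2 = (d * c + d ^ 2 / 2) / d := by field_simp
  rw [e]
  refine tendsto_div_atTop_of_monotone hd ?_ ?_
  · intro x hx y hy hxy
    exact intervalIntegral.integral_mono_interval le_rfl hx hxy
      (ae_of_all _ fun s => eventDelay_nonneg hd hv s) (hi _ _)
  · have h1 := ((tendsto_succ_div
      (Y := fun n : ℕ => ∑ k ∈ Finset.range n, sojourn d 0 v k) h).const_mul d).add_const (d ^ 2 / 2)
    refine h1.congr' ?_
    filter_upwards [eventually_gt_atTop 0] with n hn
    have : (n : ℝ) ≠ 0 := by positivity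
    rw [integral_eventDelay hd hv]
    field_simp

/-- Cauchy–Schwarz, from the nonnegativity of the variance on [0, x]. -/
theorem sq_integral_eventDelay_le {d : ℝ} (hd : 0 < d) {v : ℕ → ℝ} (hv : ∀ k, 0 ≤ v k)
    (a : ℝ) {x : ℝ} (hx : 0 ≤ x) :
    (∫ u in (0 : ℝ)..x, eventDelay d v (a + u)) ^ 2 ≤
      x * ∫ u in (0 : ℝ)..x, eventDelay d v (a + u) ^ 2 := by
  rcases hx.eq_or_lt with rfl | hx0
  · simp
  have hi1 := intervalIntegrable_eventDelay hd hv a 0 x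
  have hi2 := intervalIntegrable_eventDelay_pow hd hv 2 a 0 x
  set I := ∫ u in (0 : ℝ)..x, eventDelay d v (a + u) with hI
  have h1 : 0 ≤ ∫ u in (0 : ℝ)..x, (eventDelay d v (a + u) - I / x) ^ 2 :=
    intervalIntegral.integral_nonneg hx fun u _ => sq_nonneg _
  have e : ∀ u, (eventDelay d v (a + u) - I / x) ^ 2 =
      eventDelay d v (a + u) ^ 2 - 2 * (I / x) * eventDelay d v (a + u) + (I / x) ^ 2 :=
    fun u => by ring
  simp_rw [e] at h1
  rw [intervalIntegral.integral_add (hi2.sub (hi1.const_mul _)) (by simp),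
    intervalIntegral.integral_sub hi2 (hi1.const_mul _), intervalIntegral.integral_const_mul,
    intervalIntegral.integral_const, ← hI, smul_eq_mul, sub_zero] at h1
  have e2 : x * (∫ u in (0 : ℝ)..x, eventDelay d v (a + u) ^ 2) - I ^ 2 =
      x * ((∫ u in (0 : ℝ)..x, eventDelay d v (a + u) ^ 2) - 2 * (I / x) * I +
        x * (I / x) ^ 2) := by
    field_simp
    ring
  have := mul_nonneg hx h1
  linarith

/-! ### Fubini for independent variables -/

theorem lintegral_of_indepFun {Ω α β : Type*} [MeasurableSpace Ω] [MeasurableSpace α]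
    [MeasurableSpace β] {P : Measure Ω} [IsProbabilityMeasure P] {U : Ω → α} {W : Ω → β}
    (hU : Measurable U) (hW : Measurable W) (h : IndepFun U W P) {H : α × β → ENNReal}
    (hH : Measurable H) :
    ∫⁻ ω, H (U ω, W ω) ∂P = ∫⁻ ω, ∫⁻ ω', H (U ω, W ω') ∂P ∂P := by
  have : IsProbabilityMeasure (P.map W) := Measure.isProbabilityMeasure_map hW.aemeasurable
  rw [← lintegral_map (f := H) (g := fun ω => (U ω, W ω)) hH (hU.prodMk hW),
    h.map_prod_eq_prod_map_map hU.aemeasurable hW.aemeasurable, lintegral_prod _ hH.aemeasurable,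
    lintegral_map hH.lintegral_prod_right' hU]
  refine lintegral_congr fun ω => ?_
  exact lintegral_map (hH.comp measurable_prodMk_left) hW

theorem integral_of_indepFun {Ω α : Type*} [MeasurableSpace Ω] [MeasurableSpace α]
    {P : Measure Ω} [IsProbabilityMeasure P] {U : Ω → α} {W : Ω → ℝ} {ν : Measure ℝ}
    (hU : Measurable U) (hW : HasLaw W ν P) (h : IndepFun U W P) {H : α × ℝ → ℝ}
    (hH : Measurable H) (hi : Integrable (fun ω => H (U ω, W ω)) P) :
    ∫ ω, H (U ω, W ω) ∂P = ∫ ω, ∫ x, H (U ω, x) ∂ν ∂P := by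
  have : IsProbabilityMeasure (P.map W) := Measure.isProbabilityMeasure_map hW.aemeasurable
  have hUW : AEMeasurable (fun ω => (U ω, W ω)) P := hU.aemeasurable.prodMk hW.aemeasurable
  have hprod := h.map_prod_eq_prod_map_map hU.aemeasurable hW.aemeasurable
  have hi' : Integrable H ((P.map U).prod (P.map W)) := by
    rw [← hprod]
    exact (integrable_map_measure hH.aestronglyMeasurable hUW).2 hi
  rw [← integral_map (φ := fun ω => (U ω, W ω)) (f := H) hUW hH.aestronglyMeasurable, hprod,
    integral_prod _ hi', ← hW.map_eq, integral_map hU.aemeasurable]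
  exact hH.stronglyMeasurable.integral_prod_right'.aestronglyMeasurable

/-- Indicators absorb the variable endpoint; the two regions are the two orientations of the
interval. -/
theorem measurable_intervalIntegral {α : Type*} [MeasurableSpace α] {f : α × ℝ → ℝ}
    (hf : Measurable f) : Measurable fun p : α × ℝ => ∫ u in (0 : ℝ)..p.2, f (p.1, u) := by
  have hg : ∀ S : Set ((α × ℝ) × ℝ), MeasurableSet S →
      Measurable fun p : α × ℝ => ∫ u, S.indicator (fun q => f (q.1.1, q.2)) (p, u) := fun S hS =>
    (((hf.comp (measurable_fst.fst.prodMk measurable_snd)).indicator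
      hS).stronglyMeasurable.integral_prod_right').measurable
  have h1 := hg {q | 0 < q.2 ∧ q.2 ≤ q.1.2}
    ((measurableSet_lt measurable_const measurable_snd).inter
      (measurableSet_le measurable_snd measurable_fst.snd))
  have h2 := hg {q | q.1.2 < q.2 ∧ q.2 ≤ 0}
    ((measurableSet_lt measurable_fst.snd measurable_snd).inter
      (measurableSet_le measurable_snd measurable_const))
  convert h1.sub h2 using 1
  funext p
  rw [intervalIntegral, ← integral_indicator measurableSet_Ioc,
    ← integral_indicator measurableSet_Ioc]
  rfl

/-! ### The delays of the events of the source -/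

/-- A Poisson source with interarrival times `X`, sampled at intervals `d` and sent to a queue with
service times `V` whose sojourn times have second moments bounded by `K`. -/
structure IsSampledSource {Ω : Type*} [MeasurableSpace Ω] (P : Measure Ω) (d lam K : ℝ)
    (X V : ℕ → Ω → ℝ) : Prop where
  d_pos : 0 < d
  lam_pos : 0 < lam
  K_nonneg : 0 ≤ K
  measurable_X : ∀ n, Measurable (X n)
  measurable_V : ∀ n, Measurable (V n)
  nonneg_X : ∀ n ω, 0 ≤ X n ω
  nonneg_V : ∀ n ω, 0 ≤ V n ω
  indep : iIndepFun (Sum.elim X V) P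
  law_X : ∀ n, HasLaw (X n) (expMeasure lam) P
  moment : ∀ k, ∫⁻ ω, ENNReal.ofReal (sojourn d 0 (fun j => V j ω) k ^ 2) ∂P ≤ ENNReal.ofReal K

namespace IsSampledSource

variable {Ω : Type*} [MeasurableSpace Ω] {P : Measure Ω} {d lam K : ℝ} {X V : ℕ → Ω → ℝ}

theorem measurable_elim (h : IsSampledSource P d lam K X V) (i : ℕ ⊕ ℕ) :
    Measurable (Sum.elim X V i) := by
  rcases i with i | i
  exacts [h.measurable_X i, h.measurable_V i]

theorem measurable_eventTime (h : IsSampledSource P d lam K X V) (n : ℕ) :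
    Measurable (eventTime X n) :=
  Finset.measurable_fun_sum _ fun k _ => h.measurable_X k

theorem eventTime_nonneg (h : IsSampledSource P d lam K X V) (n : ℕ) (ω : Ω) :
    0 ≤ eventTime X n ω := Finset.sum_nonneg fun k _ => h.nonneg_X k ω

theorem measurable_service (h : IsSampledSource P d lam K X V) :
    Measurable fun ω j => V j ω := measurable_pi_lambda _ h.measurable_V

theorem lintegral_eventDelay_sq_le (h : IsSampledSource P d lam K X V) [IsProbabilityMeasure P]
    {s : ℝ} (hs : 0 ≤ s) :
    ∫⁻ ω, ENNReal.ofReal (eventDelay d (fun j => V j ω) s ^ 2) ∂P ≤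
      ENNReal.ofReal (2 * K + 2 * d ^ 2) := by
  have hd := h.d_pos
  have hK := h.K_nonneg
  have hb : ∀ ω, ENNReal.ofReal (eventDelay d (fun j => V j ω) s ^ 2) ≤
      ENNReal.ofReal 2 * ENNReal.ofReal (sojourn d 0 (fun j => V j ω) ⌈s / d⌉₊ ^ 2) +
        ENNReal.ofReal (2 * d ^ 2) := fun ω => by
    rw [← ENNReal.ofReal_mul zero_le_two, ← ENNReal.ofReal_add (by positivity) (by positivity)]
    refine ENNReal.ofReal_le_ofReal ?_
    have h1 : 0 ≤ ⌈s / d⌉₊ * d - s := sub_nonneg.2 (le_ceil_div_mul hd s)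
    have h2 : ⌈s / d⌉₊ * d - s ≤ d := by
      have h3 := (Nat.ceil_lt_add_one (div_nonneg hs hd.le)).le
      have h4 := mul_le_mul_of_nonneg_right h3 hd.le
      rw [add_mul, div_mul_cancel₀ _ hd.ne'] at h4
      linarith
    unfold eventDelay
    nlinarith [sq_nonneg (sojourn d 0 (fun j => V j ω) ⌈s / d⌉₊ - (⌈s / d⌉₊ * d - s))]
  refine (lintegral_mono hb).trans ?_
  rw [lintegral_add_right _ measurable_const, lintegral_const_mul' _ _ ENNReal.ofReal_ne_top,
    lintegral_const, measure_univ, mul_one, ENNReal.ofReal_add (by positivity) (by positivity),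
    ENNReal.ofReal_mul (p := 2) (q := K) zero_le_two]
  gcongr _ * ?_ + _
  exact h.moment _

variable (d X V) in
/-- Delay of event `n + 1`. -/
noncomputable def jump (n : ℕ) (ω : Ω) : ℝ :=
  eventDelay d (fun j => V j ω) (eventTime X n ω + X n ω)

variable (d lam X V) in
/-- Compensator of the delay of event `n + 1`. -/
noncomputable def compensator (n : ℕ) (ω : Ω) : ℝ :=
  lam * ∫ u in (0 : ℝ)..X n ω, eventDelay d (fun j => V j ω) (eventTime X n ω + u)

theorem measurable_eventDelay_shift (d : ℝ) :
    Measurable fun p : ((ℕ → ℝ) × ℝ) × ℝ => eventDelay d p.1.1 (p.1.2 + p.2) :=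
  (measurable_eventDelay d).comp
    (measurable_fst.fst.prodMk (measurable_fst.snd.add measurable_snd))

theorem measurable_integral_eventDelay_shift (d : ℝ) :
    Measurable fun p : ((ℕ → ℝ) × ℝ) × ℝ =>
      ∫ u in (0 : ℝ)..p.2, eventDelay d p.1.1 (p.1.2 + u) :=
  measurable_intervalIntegral (measurable_eventDelay_shift d)

theorem measurable_jump {Ω : Type*} {m : MeasurableSpace Ω} {d : ℝ} {X V : ℕ → Ω → ℝ}
    {n : ℕ} (hV : ∀ j, Measurable[m] (V j))
    (hX : ∀ k < n + 1, Measurable[m] (X k)) : Measurable[m] (jump d X V n) :=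
  (measurable_eventDelay d).comp ((measurable_pi_lambda _ hV).prodMk
    ((Finset.measurable_fun_sum _ fun k hk =>
      hX k ((Finset.mem_range.1 hk).trans n.lt_succ_self)).add (hX n n.lt_succ_self)))

theorem measurable_compensator {Ω : Type*} {m : MeasurableSpace Ω} {d lam : ℝ} {X V : ℕ → Ω → ℝ}
    {n : ℕ} (hV : ∀ j, Measurable[m] (V j))
    (hX : ∀ k < n + 1, Measurable[m] (X k)) : Measurable[m] (compensator d lam X V n) :=
  ((measurable_integral_eventDelay_shift d).comp (((measurable_pi_lambda _ hV).prodMk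
    (Finset.measurable_fun_sum _ fun k hk =>
      hX k ((Finset.mem_range.1 hk).trans n.lt_succ_self))).prodMk (hX n n.lt_succ_self))).const_mul _

theorem indepFun_service (h : IsSampledSource P d lam K X V) {β : Type*} [MeasurableSpace β]
    {U : Ω → β} (hU : Measurable[coordSigma (Sum.elim X V) (Set.range Sum.inl)] U) :
    IndepFun U (fun ω j => V j ω) P := by
  refine indepFun_of_coordSigma h.measurable_elim h.indep (S := Set.range Sum.inl)
    (T := Set.range Sum.inr) ?_ hU ?_
  · rw [Set.disjoint_left]
    rintro _ ⟨i, rfl⟩ ⟨j, hj⟩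
    cases hj
  · exact @measurable_pi_lambda _ _ _ (_) _ _ fun j =>
      measurable_coordSigma (Sum.elim X V) (i := Sum.inr j) ⟨j, rfl⟩

theorem measurable_coord_X {Ω : Type*} {X V : ℕ → Ω → ℝ} (n : ℕ) :
    Measurable[coordSigma (Sum.elim X V) (Set.range Sum.inl)] (X n) :=
  measurable_coordSigma (Sum.elim X V) (i := Sum.inl n) ⟨n, rfl⟩

/-- Event times are independent of the service times, so the bound at a deterministic time can be
averaged over them. -/
theorem lintegral_jump_sq_le (h : IsSampledSource P d lam K X V) [IsProbabilityMeasure P] (n : ℕ) :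
    ∫⁻ ω, ENNReal.ofReal (jump d X V n ω ^ 2) ∂P ≤ ENNReal.ofReal (2 * K + 2 * d ^ 2) := by
  have hs : Measurable[coordSigma (Sum.elim X V) (Set.range Sum.inl)]
      fun ω => eventTime X n ω + X n ω :=
    (Finset.measurable_fun_sum _ fun k _ => measurable_coord_X k).add (measurable_coord_X n)
  have hsm : Measurable fun ω => eventTime X n ω + X n ω :=
    (h.measurable_eventTime n).add (h.measurable_X n)
  have hH : Measurable fun p : ℝ × (ℕ → ℝ) => ENNReal.ofReal (eventDelay d p.2 p.1 ^ 2) :=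
    (((measurable_eventDelay d).comp (measurable_snd.prodMk measurable_fst)).pow_const
      2).ennreal_ofReal
  have e := lintegral_of_indepFun hsm h.measurable_service (h.indepFun_service hs) hH
  refine e.le.trans ?_
  refine (lintegral_mono (g := fun _ => ENNReal.ofReal (2 * K + 2 * d ^ 2)) fun ω => ?_).trans
    (by simp)
  exact h.lintegral_eventDelay_sq_le (add_nonneg (h.eventTime_nonneg n ω) (h.nonneg_X n ω))

theorem memLp_two_of_lintegral_sq_le {f : Ω → ℝ} (hf : Measurable f) {C : ENNReal} (hC : C ≠ ⊤)
    (h : ∫⁻ ω, ENNReal.ofReal (f ω ^ 2) ∂P ≤ C) : MemLp f 2 P := by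
  rw [memLp_two_iff_integrable_sq hf.aestronglyMeasurable]
  refine ⟨(hf.pow_const 2).aestronglyMeasurable, ?_⟩
  rw [hasFiniteIntegral_iff_ofReal (ae_of_all _ fun ω => sq_nonneg _)]
  exact lt_of_le_of_lt h hC.lt_top

/-- Cauchy–Schwarz in u, then Tonelli and the bound at each fixed time. -/
theorem lintegral_integral_eventDelay_sq_le (h : IsSampledSource P d lam K X V)
    [IsProbabilityMeasure P] {a x : ℝ} (ha : 0 ≤ a) (hx : 0 ≤ x) :
    ∫⁻ ω, ENNReal.ofReal ((∫ u in (0 : ℝ)..x, eventDelay d (fun j => V j ω) (a + u)) ^ 2) ∂P ≤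
      ENNReal.ofReal (2 * K + 2 * d ^ 2) * ENNReal.ofReal (x ^ 2) := by
  have hd := h.d_pos
  have h1 : ∀ ω, ENNReal.ofReal
      ((∫ u in (0 : ℝ)..x, eventDelay d (fun j => V j ω) (a + u)) ^ 2) ≤
      ENNReal.ofReal x * ∫⁻ u in Set.Ioc 0 x,
        ENNReal.ofReal (eventDelay d (fun j => V j ω) (a + u) ^ 2) := fun ω => by
    rw [← ofReal_integral_eq_lintegral_ofReal
      (intervalIntegrable_eventDelay_pow hd (fun k => h.nonneg_V k ω) 2 a 0 x).1
      (ae_of_all _ fun u => sq_nonneg _), ← ENNReal.ofReal_mul hx,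
      ← intervalIntegral.integral_of_le hx]
    exact ENNReal.ofReal_le_ofReal (sq_integral_eventDelay_le hd (fun k => h.nonneg_V k ω) a hx)
  have hm : Measurable fun p : Ω × ℝ =>
      ENNReal.ofReal (eventDelay d (fun j => V j p.1) (a + p.2) ^ 2) :=
    (((measurable_eventDelay d).comp ((h.measurable_service.comp measurable_fst).prodMk
      (measurable_snd.const_add a))).pow_const 2).ennreal_ofReal
  calc _ ≤ ∫⁻ ω, (ENNReal.ofReal x * ∫⁻ u in Set.Ioc 0 x,
        ENNReal.ofReal (eventDelay d (fun j => V j ω) (a + u) ^ 2)) ∂P := lintegral_mono h1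
    _ = ENNReal.ofReal x * ∫⁻ u in Set.Ioc 0 x, ∫⁻ ω,
        ENNReal.ofReal (eventDelay d (fun j => V j ω) (a + u) ^ 2) ∂P := by
        rw [lintegral_const_mul' _ _ ENNReal.ofReal_ne_top, lintegral_lintegral_swap
          (f := fun ω u => ENNReal.ofReal (eventDelay d (fun j => V j ω) (a + u) ^ 2))
          hm.aemeasurable]
    _ ≤ ENNReal.ofReal x * ∫⁻ _ in Set.Ioc 0 x, ENNReal.ofReal (2 * K + 2 * d ^ 2) := by
        gcongr 1
        refine setLIntegral_mono measurable_const fun u hu => ?_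
        exact h.lintegral_eventDelay_sq_le (add_nonneg ha hu.1.le)
    _ = ENNReal.ofReal (2 * K + 2 * d ^ 2) * ENNReal.ofReal (x ^ 2) := by
        rw [setLIntegral_const, Real.volume_Ioc, sub_zero, sq x, ENNReal.ofReal_mul hx]
        ring

theorem lintegral_compensator_sq_le (h : IsSampledSource P d lam K X V) [IsProbabilityMeasure P]
    (n : ℕ) :
    ∫⁻ ω, ENNReal.ofReal (compensator d lam X V n ω ^ 2) ∂P ≤
      ENNReal.ofReal (lam ^ 2 * ((2 * K + 2 * d ^ 2) * ∫ x, x ^ 2 ∂(expMeasure lam))) := by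
  have hK := h.K_nonneg
  have hU : Measurable[coordSigma (Sum.elim X V) (Set.range Sum.inl)]
      fun ω => (eventTime X n ω, X n ω) :=
    (Finset.measurable_fun_sum _ fun k _ => measurable_coord_X k).prodMk (measurable_coord_X n)
  have hUm : Measurable fun ω => (eventTime X n ω, X n ω) :=
    (h.measurable_eventTime n).prodMk (h.measurable_X n)
  have hH : Measurable fun p : (ℝ × ℝ) × (ℕ → ℝ) => ENNReal.ofReal
      ((∫ u in (0 : ℝ)..p.1.2, eventDelay d p.2 (p.1.1 + u)) ^ 2) :=
    (((measurable_integral_eventDelay_shift d).comp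
      ((measurable_snd.prodMk measurable_fst.fst).prodMk measurable_fst.snd)).pow_const
      2).ennreal_ofReal
  have e := lintegral_of_indepFun hUm h.measurable_service (h.indepFun_service hU) hH
  have e1 : ∀ ω, ENNReal.ofReal (compensator d lam X V n ω ^ 2) = ENNReal.ofReal (lam ^ 2) *
      ENNReal.ofReal ((∫ u in (0 : ℝ)..X n ω,
        eventDelay d (fun j => V j ω) (eventTime X n ω + u)) ^ 2) := fun ω => by
    rw [compensator, mul_pow, ENNReal.ofReal_mul (sq_nonneg _)]
  rw [lintegral_congr e1, lintegral_const_mul' _ _ ENNReal.ofReal_ne_top, e,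
    ENNReal.ofReal_mul (sq_nonneg _)]
  gcongr
  calc _ ≤ ∫⁻ ω, ENNReal.ofReal (2 * K + 2 * d ^ 2) * ENNReal.ofReal (X n ω ^ 2) ∂P :=
        lintegral_mono fun ω => h.lintegral_integral_eventDelay_sq_le
          (h.eventTime_nonneg n ω) (h.nonneg_X n ω)
    _ = _ := by
        rw [lintegral_const_mul' _ _ ENNReal.ofReal_ne_top, ENNReal.ofReal_mul (by positivity),
          ofReal_integral_eq_lintegral_ofReal (memLp_two_expMeasure h.lam_pos).integrable_sq
            (ae_of_all _ fun x => sq_nonneg _), (h.law_X n).lintegral_comp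
            (f := fun x => ENNReal.ofReal (x ^ 2)) (by fun_prop)]

theorem memLp_jump (h : IsSampledSource P d lam K X V) [IsProbabilityMeasure P] (n : ℕ) :
    MemLp (jump d X V n) 2 P :=
  memLp_two_of_lintegral_sq_le (measurable_jump h.measurable_V fun k _ => h.measurable_X k)
    ENNReal.ofReal_ne_top (h.lintegral_jump_sq_le n)

theorem memLp_compensator (h : IsSampledSource P d lam K X V) [IsProbabilityMeasure P] (n : ℕ) :
    MemLp (compensator d lam X V n) 2 P :=
  memLp_two_of_lintegral_sq_le (measurable_compensator h.measurable_V fun k _ => h.measurable_X k)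
    ENNReal.ofReal_ne_top (h.lintegral_compensator_sq_le n)

theorem exists_integral_increment_sq_le (h : IsSampledSource P d lam K X V)
    [IsProbabilityMeasure P] : ∃ c, 0 ≤ c ∧ ∀ n,
      ∫ ω, (jump d X V n ω - compensator d lam X V n ω) ^ 2 ∂P ≤ c := by
  have hK := h.K_nonneg
  have hI : 0 ≤ ∫ x, x ^ 2 ∂(expMeasure lam) := integral_nonneg fun x => sq_nonneg _
  refine ⟨2 * (2 * K + 2 * d ^ 2) +
    2 * (lam ^ 2 * ((2 * K + 2 * d ^ 2) * ∫ x, x ^ 2 ∂(expMeasure lam))), by positivity,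
    fun n => ?_⟩
  have h1 : ∫ ω, jump d X V n ω ^ 2 ∂P ≤ 2 * K + 2 * d ^ 2 := by
    rw [integral_eq_lintegral_of_nonneg_ae (ae_of_all _ fun ω => sq_nonneg _)
      (h.memLp_jump n).integrable_sq.aestronglyMeasurable]
    exact ENNReal.toReal_le_of_le_ofReal (by positivity) (h.lintegral_jump_sq_le n)
  have h2 : ∫ ω, compensator d lam X V n ω ^ 2 ∂P ≤
      lam ^ 2 * ((2 * K + 2 * d ^ 2) * ∫ x, x ^ 2 ∂(expMeasure lam)) := by
    rw [integral_eq_lintegral_of_nonneg_ae (ae_of_all _ fun ω => sq_nonneg _)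
      (h.memLp_compensator n).integrable_sq.aestronglyMeasurable]
    exact ENNReal.toReal_le_of_le_ofReal (by positivity) (h.lintegral_compensator_sq_le n)
  calc _ ≤ ∫ ω, (2 * jump d X V n ω ^ 2 + 2 * compensator d lam X V n ω ^ 2) ∂P := by
        refine integral_mono ((h.memLp_jump n).sub (h.memLp_compensator n)).integrable_sq
          (((h.memLp_jump n).integrable_sq.const_mul 2).add
            ((h.memLp_compensator n).integrable_sq.const_mul 2)) fun ω => ?_
        simp only
        nlinarith [sq_nonneg (jump d X V n ω + compensator d lam X V n ω)]
    _ = 2 * ∫ ω, jump d X V n ω ^ 2 ∂P + 2 * ∫ ω, compensator d lam X V n ω ^ 2 ∂P := by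
        rw [integral_add ((h.memLp_jump n).integrable_sq.const_mul 2)
          ((h.memLp_compensator n).integrable_sq.const_mul 2), integral_const_mul,
          integral_const_mul]
    _ ≤ _ := by gcongr

/-- The compensated delays are orthogonal to the past. -/
theorem integral_mul_increment_eq_zero (h : IsSampledSource P d lam K X V)
    [IsProbabilityMeasure P] {i j : ℕ} (hij : i < j) :
    ∫ ω, (jump d X V i ω - compensator d lam X V i ω) *
      (jump d X V j ω - compensator d lam X V j ω) ∂P = 0 := by
  -- The past of event j + 1 includes all service times, even future ones; this is harmless since `X
  -- j` is independent of them.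
  set T : Set (ℕ ⊕ ℕ) := Set.range Sum.inr ∪ Sum.inl '' Set.Iio j with hT
  have hVT : ∀ k, Measurable[coordSigma (Sum.elim X V) T] (V k) := fun k =>
    measurable_coordSigma (Sum.elim X V) (i := Sum.inr k) (Or.inl ⟨k, rfl⟩)
  have hXT : ∀ k < j, Measurable[coordSigma (Sum.elim X V) T] (X k) := fun k hk =>
    measurable_coordSigma (Sum.elim X V) (i := Sum.inl k) (Or.inr ⟨k, hk, rfl⟩)
  set U : Ω → ((ℕ → ℝ) × ℝ) × ℝ := fun ω =>
    (((fun k => V k ω), eventTime X j ω), jump d X V i ω - compensator d lam X V i ω) with hU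
  have hξT : Measurable[coordSigma (Sum.elim X V) T]
      fun ω => jump d X V i ω - compensator d lam X V i ω :=
    (measurable_jump hVT fun k hk => hXT k (by omega)).sub
      (measurable_compensator hVT fun k hk => hXT k (by omega))
  have hUT : Measurable[coordSigma (Sum.elim X V) T] U :=
    ((@measurable_pi_lambda _ _ _ (_) _ _ hVT).prodMk
      (Finset.measurable_fun_sum _ fun k hk => hXT k (Finset.mem_range.1 hk))).prodMk hξT
  have hUm : Measurable U :=
    hUT.mono (iSup₂_le fun k _ => (h.measurable_elim k).comap_le) le_rfl
  have hind : IndepFun U (X j) P := by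
    refine indepFun_of_coordSigma h.measurable_elim h.indep (S := T) (T := {Sum.inl j}) ?_ hUT
      (measurable_coordSigma (Sum.elim X V) (i := Sum.inl j) rfl)
    rw [Set.disjoint_singleton_right]
    rintro (⟨k, hk⟩ | ⟨k, hk, hk'⟩)
    · cases hk
    · obtain rfl : k = j := Sum.inl.inj hk'
      exact lt_irrefl k hk
  have hi1 : Integrable (fun ω => (jump d X V i ω - compensator d lam X V i ω) * jump d X V j ω) P :=
    ((h.memLp_jump i).sub (h.memLp_compensator i)).integrable_mul (h.memLp_jump j)
  have hi2 : Integrable (fun ω => (jump d X V i ω - compensator d lam X V i ω) *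
      compensator d lam X V j ω) P :=
    ((h.memLp_jump i).sub (h.memLp_compensator i)).integrable_mul (h.memLp_compensator j)
  have e1 : ∫ ω, (jump d X V i ω - compensator d lam X V i ω) * jump d X V j ω ∂P =
      ∫ ω, ∫ x, (jump d X V i ω - compensator d lam X V i ω) *
        eventDelay d (fun k => V k ω) (eventTime X j ω + x) ∂(expMeasure lam) ∂P :=
    integral_of_indepFun (H := fun p : (((ℕ → ℝ) × ℝ) × ℝ) × ℝ =>
      p.1.2 * eventDelay d p.1.1.1 (p.1.1.2 + p.2)) hUm (h.law_X j) hind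
      (measurable_fst.snd.mul ((measurable_eventDelay_shift d).comp
        (measurable_fst.fst.prodMk measurable_snd))) hi1
  have e2 : ∫ ω, (jump d X V i ω - compensator d lam X V i ω) * compensator d lam X V j ω ∂P =
      ∫ ω, ∫ x, (jump d X V i ω - compensator d lam X V i ω) *
        (lam * ∫ u in (0 : ℝ)..x, eventDelay d (fun k => V k ω) (eventTime X j ω + u))
          ∂(expMeasure lam) ∂P :=
    integral_of_indepFun (H := fun p : (((ℕ → ℝ) × ℝ) × ℝ) × ℝ =>
      p.1.2 * (lam * ∫ u in (0 : ℝ)..p.2, eventDelay d p.1.1.1 (p.1.1.2 + u))) hUm (h.law_X j) hind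
      (measurable_fst.snd.mul (((measurable_integral_eventDelay_shift d).comp
        (measurable_fst.fst.prodMk measurable_snd)).const_mul lam)) hi2
  simp_rw [mul_sub (jump d X V i _ - compensator d lam X V i _)]
  rw [integral_sub hi1 hi2, e1, e2, sub_eq_zero]
  -- Given the past, only `X j` is random, and the constant hazard rate identity equates the two
  -- inner integrals.
  refine integral_congr_ae (ae_of_all _ fun ω => ?_)
  simp only
  rw [integral_const_mul, integral_const_mul,
    integral_expMeasure_eq_integral_primitive (ψ := fun x =>
      eventDelay d (fun k => V k ω) (eventTime X j ω + x)) h.lam_pos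
      ((measurable_eventDelay d).comp (measurable_const.prodMk (measurable_const_add _)))
      (fun x => eventDelay_nonneg h.d_pos (fun k => h.nonneg_V k ω) _)
      (intervalIntegrable_eventDelay h.d_pos (fun k => h.nonneg_V k ω) _)]

/-- The interarrival intervals tile [0, s_m]. -/
theorem sum_compensator (h : IsSampledSource P d lam K X V) (m : ℕ) (ω : Ω) :
    ∑ n ∈ Finset.range m, compensator d lam X V n ω =
      lam * ∫ s in (0 : ℝ)..eventTime X m ω, eventDelay d (fun j => V j ω) s := by
  have hi : ∀ x y, IntervalIntegrable (eventDelay d fun j => V j ω) volume x y := fun x y => by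
    simpa using intervalIntegrable_eventDelay h.d_pos (fun k => h.nonneg_V k ω) 0 x y
  induction m with
  | zero => simp [eventTime]
  | succ m ih =>
    rw [Finset.sum_range_succ, ih, compensator,
      intervalIntegral.integral_comp_add_left (fun s => eventDelay d (fun j => V j ω) s),
      ← mul_add, add_zero, intervalIntegral.integral_add_adjacent_intervals (hi _ _) (hi _ _),
      eventTime, eventTime, Finset.sum_range_succ]

/-- Long-run average delay per event of the source. -/
theorem ae_tendsto_average_jump (h : IsSampledSource P d lam K X V) [IsProbabilityMeasure P]
    {c : ℝ} (hs : ∀ᵐ ω ∂P, Tendsto (fun n : ℕ => eventTime X n ω / n) atTop (𝓝 (1 / lam)))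
    (hc : ∀ᵐ ω ∂P, Tendsto (fun n : ℕ => (∑ k ∈ Finset.range n,
      sojourn d 0 (fun j => V j ω) k) / n) atTop (𝓝 c)) :
    ∀ᵐ ω ∂P, Tendsto (fun m : ℕ => (∑ n ∈ Finset.range m, jump d X V n ω) / m) atTop
      (𝓝 (c + d / 2)) := by
  obtain ⟨C, hC0, hC⟩ := h.exists_integral_increment_sq_le
  have hlam := h.lam_pos
  -- Orthogonality is the case p = 0: as 0 ^ 0 = 1, only the diagonal keeps the bound C.
  have hmain := ae_tendsto_sum_range_sq_div (P := P) (p := 0) (c := C)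
    (Y := fun n ω => jump d X V n ω - compensator d lam X V n ω)
    (fun n => (h.memLp_jump n).sub (h.memLp_compensator n)) le_rfl zero_lt_one hC0
    (fun i k => by
      rcases Nat.eq_zero_or_pos k with rfl | hk
      · simpa [← sq] using hC i
      · rw [h.integral_mul_increment_eq_zero (by omega), zero_pow hk.ne', mul_zero])
  filter_upwards [hs, hc, hmain] with ω hω1 hω2 hω3
  refine tendsto_div_of_monotone_of_tendsto_sq
    (u := fun m => ∑ n ∈ Finset.range m, jump d X V n ω) ?_ ?_
  · refine monotone_nat_of_le_succ fun n => ?_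
    rw [Finset.sum_range_succ]
    linarith [eventDelay_nonneg h.d_pos (fun k => h.nonneg_V k ω) (eventTime X n ω + X n ω),
      show jump d X V n ω = eventDelay d (fun j => V j ω) (eventTime X n ω + X n ω) from rfl]
  · have htendsto := tendsto_atTop_of_tendsto_div (one_div_pos.2 hlam) hω1
    have h1 := (((tendsto_integral_eventDelay_div h.d_pos (fun k => h.nonneg_V k ω) hω2).comp
      htendsto).mul hω1).const_mul lam
    have h2 := (h1.comp (tendsto_pow_atTop two_ne_zero)).add hω3
    have e : lam * ((c + d / 2) * (1 / lam)) + 0 = c + d / 2 := by field_simp; ring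
    rw [e] at h2
    refine h2.congr' ?_
    have h3 := (htendsto.comp (tendsto_pow_atTop (α := ℕ) two_ne_zero)).eventually_gt_atTop 0
    filter_upwards [h3, eventually_gt_atTop 0] with k hk hk0
    have hk1 : ((k ^ 2 : ℕ) : ℝ) ≠ 0 := by positivity
    have hk2 : eventTime X (k ^ 2) ω ≠ 0 := (hk : 0 < eventTime X (k ^ 2) ω).ne'
    rw [Finset.sum_sub_distrib, h.sum_compensator]
    simp only [Function.comp]
    field_simp
    ring

end IsSampledSource

/-! ### The distortion along a sample path -/

section SamplePath

variable {Ω : Type*} {d : ℝ} {X V : ℕ → Ω → ℝ} {ω : Ω}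

theorem eventTime_succ (X : ℕ → Ω → ℝ) (n : ℕ) (ω : Ω) :
    eventTime X (n + 1) ω = eventTime X n ω + X n ω := Finset.sum_range_succ _ _

theorem strictMono_eventTime (hX : ∀ n, 0 < X n ω) : StrictMono fun n => eventTime X n ω :=
  strictMono_nat_of_lt_succ fun n => by
    rw [eventTime_succ]
    linarith [hX n]

theorem eventTime_succ_pos (hX : ∀ n, 0 < X n ω) (n : ℕ) : 0 < eventTime X (n + 1) ω := by
  have := strictMono_eventTime hX n.succ_pos
  simpa [eventTime] using this

theorem deliveryTime_eq (d : ℝ) (V : ℕ → Ω → ℝ) (k : ℕ) (ω : Ω) :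
    deliveryTime d V k ω = k * d + sojourn d 0 (fun j => V j ω) k := by
  induction k with
  | zero => simp [deliveryTime, sojourn]
  | succ k ih =>
    rw [deliveryTime, sojourn, ih, ← add_assoc, add_right_cancel_iff, ← max_add_add_left]
    push_cast
    rw [max_comm]
    congr 1 <;> ring

theorem mul_le_deliveryTime (hV : ∀ n, 0 ≤ V n ω) (k : ℕ) : k * d ≤ deliveryTime d V k ω := by
  rw [deliveryTime_eq]
  linarith [sojourn_nonneg (d := d) le_rfl hV k]

theorem monotone_deliveryTime (hV : ∀ n, 0 ≤ V n ω) : Monotone fun k => deliveryTime d V k ω :=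
  monotone_nat_of_le_succ fun k => by
    rw [deliveryTime]
    linarith [hV k, le_max_right (((k + 1 : ℕ) : ℝ) * d) (deliveryTime d V k ω)]

theorem deliveryTime_ceil (d : ℝ) (X V : ℕ → Ω → ℝ) (n : ℕ) (ω : Ω) :
    deliveryTime d V ⌈eventTime X (n + 1) ω / d⌉₊ ω =
      eventTime X (n + 1) ω + IsSampledSource.jump d X V n ω := by
  rw [IsSampledSource.jump, eventDelay, ← eventTime_succ, deliveryTime_eq]
  ring

/-- The supremum is attained: for t ≥ 0 the set contains 0, and it is bounded because sample i is
not delivered before i * d. -/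
theorem le_latestReceived_iff (hd : 0 < d) (hV : ∀ n, 0 ≤ V n ω) {t : ℝ} (ht : 0 ≤ t) (i : ℕ) :
    i ≤ latestReceived d V t ω ↔ deliveryTime d V i ω ≤ t := by
  have hne : {i : ℕ | deliveryTime d V i ω ≤ t}.Nonempty := ⟨0, by simpa [deliveryTime] using ht⟩
  have hbd : BddAbove {i : ℕ | deliveryTime d V i ω ≤ t} := by
    refine ⟨⌊t / d⌋₊, fun i hi => Nat.le_floor ?_⟩
    rw [le_div_iff₀ hd]
    exact (mul_le_deliveryTime hV i).trans hi
  constructor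
  · intro h
    exact (monotone_deliveryTime hV h).trans (Nat.sSup_mem hne hbd)
  · intro h
    exact le_csSup hbd h

theorem latestReceived_mul_le (hd : 0 < d) (hV : ∀ n, 0 ≤ V n ω) {t : ℝ} (ht : 0 ≤ t) :
    latestReceived d V t ω * d ≤ t :=
  (mul_le_deliveryTime hV _).trans ((le_latestReceived_iff hd hV ht _).1 le_rfl)

theorem countingProcess_eq_sum (hX : ∀ n, 0 < X n ω) {N : ℕ} {t : ℝ}
    (ht : t < eventTime X (N + 1) ω) :
    (countingProcess X t ω : ℝ) =
      ∑ n ∈ Finset.range N, if eventTime X (n + 1) ω ≤ t then (1 : ℝ) else 0 := by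
  have h : {n : ℕ | 1 ≤ n ∧ eventTime X n ω ≤ t} =
      (((Finset.range N).filter fun n => eventTime X (n + 1) ω ≤ t).image (· + 1) : Finset ℕ) := by
    ext n
    simp only [Set.mem_ofPred_eq, Finset.coe_image, Finset.coe_filter, Finset.mem_range,
      Set.mem_image]
    constructor
    · rintro ⟨h1, h2⟩
      obtain ⟨m, rfl⟩ := Nat.exists_eq_add_of_le' h1
      have := (strictMono_eventTime hX).lt_iff_lt.1 (h2.trans_lt ht)
      exact ⟨m, ⟨by omega, h2⟩, rfl⟩
    · rintro ⟨m, ⟨h1, h2⟩, rfl⟩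
      exact ⟨by omega, h2⟩
  rw [countingProcess, h, Set.ncard_coe_finset,
    Finset.card_image_of_injective _ (add_left_injective 1), Finset.card_filter]
  push_cast
  rfl

/-- Sample i counts an event at s iff ⌈s / d⌉ ≤ i, so the reconstruction counts it by time t iff
sample ⌈s / d⌉ has been delivered by t. -/
theorem distortion_eq_sum (hd : 0 < d) (hX : ∀ n, 0 < X n ω) (hV : ∀ n, 0 ≤ V n ω) {N : ℕ} {t : ℝ}
    (ht0 : 0 ≤ t) (ht : t < eventTime X (N + 1) ω) :
    distortion d X V t ω = ∑ n ∈ Finset.range N, ((if eventTime X (n + 1) ω ≤ t then (1 : ℝ) else 0) -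
      if eventTime X (n + 1) ω + IsSampledSource.jump d X V n ω ≤ t then (1 : ℝ) else 0) := by
  rw [distortion, reconstructedProcess, countingProcess_eq_sum hX ht,
    countingProcess_eq_sum hX ((latestReceived_mul_le hd hV ht0).trans_lt ht),
    ← Finset.sum_sub_distrib]
  refine Finset.sum_congr rfl fun n _ => ?_
  congr 1
  refine if_congr ?_ rfl rfl
  rw [← deliveryTime_ceil, ← le_latestReceived_iff hd hV ht0, Nat.ceil_le, div_le_iff₀ hd]

theorem distortion_of_nonpos (hd : 0 < d) (hX : ∀ n, 0 < X n ω) (hV : ∀ n, 0 ≤ V n ω) {t : ℝ}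
    (ht : t ≤ 0) : distortion d X V t ω = 0 := by
  rcases ht.eq_or_lt with rfl | ht'
  · rw [distortion_eq_sum hd hX hV le_rfl (eventTime_succ_pos hX 0)]
    simp
  · have h1 : ∀ s ≤ 0, (countingProcess X s ω : ℝ) = 0 := fun s hs => by
      rw [countingProcess_eq_sum hX (hs.trans_lt (eventTime_succ_pos hX 0))]
      simp
    have h2 : latestReceived d V t ω = 0 := by
      -- For t < 0 not even index 0 is available, and the supremum of the empty set is 0 by
      -- convention.
      have : {i : ℕ | deliveryTime d V i ω ≤ t} = ∅ := by
        refine Set.eq_empty_of_forall_notMem fun i hi => ?_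
        have := (mul_le_deliveryTime (d := d) hV i).trans hi
        have : 0 ≤ i * d := by positivity
        linarith
      rw [latestReceived, this]
      simp
    rw [distortion, reconstructedProcess, h1 t ht, h1 _ (by rw [h2]; simp), sub_zero]

theorem monotone_ite_le (a : ℝ) : Monotone fun t : ℝ => if a ≤ t then (1 : ℝ) else 0 := by
  intro x y hxy
  by_cases h : a ≤ x
  · simp [h, h.trans hxy]
  · simp only [h, if_false]
    split_ifs <;> simp

theorem integral_ite_le {a T : ℝ} (ha : 0 < a) (hT : 0 ≤ T) :
    ∫ t in (0 : ℝ)..T, (if a ≤ t then (1 : ℝ) else 0) = max (T - a) 0 := by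
  have h1 : (fun t : ℝ => if a ≤ t then (1 : ℝ) else 0) = (Set.Ici a).indicator fun _ => 1 := by
    funext t
    simp [Set.indicator_apply]
  have h2 : Set.Ioc 0 T ∩ Set.Ici a = Set.Icc a T := by
    ext t
    simp only [Set.mem_inter_iff, Set.mem_Ioc, Set.mem_Ici, Set.mem_Icc]
    exact ⟨fun h => ⟨h.2, h.1.2⟩, fun h => ⟨⟨ha.trans_le h.1, h.2⟩, h.1⟩⟩
  rw [intervalIntegral.integral_of_le hT, h1, setIntegral_indicator measurableSet_Ici, h2]
  simp [Measure.real, ENNReal.toReal_ofReal']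

theorem intervalIntegrable_distortion (hd : 0 < d) (hX : ∀ n, 0 < X n ω) (hV : ∀ n, 0 ≤ V n ω)
    (hs : Tendsto (fun n => eventTime X n ω) atTop atTop) (T : ℝ) :
    IntervalIntegrable (fun t => distortion d X V t ω) volume 0 T := by
  rcases le_or_gt T 0 with hT | hT
  · refine (intervalIntegrable_const (c := (0 : ℝ))).congr fun t ht => ?_
    rw [Set.uIoc_of_ge hT] at ht
    exact (distortion_of_nonpos hd hX hV ht.2).symm
  · obtain ⟨N, hN⟩ := exists_index_of_tendsto_atTop hs
    have hN' := (hN T (by simpa [eventTime] using hT.le)).2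
    have h1 : IntervalIntegrable (fun t => ∑ n ∈ Finset.range (N T),
        ((if eventTime X (n + 1) ω ≤ t then (1 : ℝ) else 0) -
        if eventTime X (n + 1) ω + IsSampledSource.jump d X V n ω ≤ t then (1 : ℝ) else 0))
        volume 0 T := by
      have h2 : ∀ n ∈ Finset.range (N T), IntervalIntegrable (fun t =>
          (if eventTime X (n + 1) ω ≤ t then (1 : ℝ) else 0) -
          if eventTime X (n + 1) ω + IsSampledSource.jump d X V n ω ≤ t then (1 : ℝ) else 0)
          volume 0 T := fun n _ => (monotone_ite_le _).intervalIntegrable.sub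
        (monotone_ite_le _).intervalIntegrable
      convert! IntervalIntegrable.sum (Finset.range (N T)) h2 using 1
      funext t
      rw [Finset.sum_apply]
    refine h1.congr fun t ht => ?_
    rw [Set.uIoc_of_le hT.le] at ht
    exact (distortion_eq_sum hd hX hV ht.1.le (ht.2.trans_lt hN')).symm

theorem jump_nonneg (hd : 0 < d) (hV : ∀ n, 0 ≤ V n ω) (n : ℕ) :
    0 ≤ IsSampledSource.jump d X V n ω := eventDelay_nonneg hd hV _

/-- Each event contributes the length of its delay interval within [0, T], written as a difference
of positive parts. -/
theorem integral_distortion (hd : 0 < d) (hX : ∀ n, 0 < X n ω) (hV : ∀ n, 0 ≤ V n ω) {N : ℕ} {T : ℝ}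
    (hT0 : 0 ≤ T) (hT : T < eventTime X (N + 1) ω) :
    ∫ t in (0 : ℝ)..T, distortion d X V t ω = ∑ n ∈ Finset.range N,
      (max (T - eventTime X (n + 1) ω) 0 -
        max (T - (eventTime X (n + 1) ω + IsSampledSource.jump d X V n ω)) 0) := by
  rw [intervalIntegral.integral_congr (g := fun t => ∑ n ∈ Finset.range N,
        ((if eventTime X (n + 1) ω ≤ t then (1 : ℝ) else 0) -
        if eventTime X (n + 1) ω + IsSampledSource.jump d X V n ω ≤ t then (1 : ℝ) else 0)),
    intervalIntegral.integral_finsetSum]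
  · refine Finset.sum_congr rfl fun n _ => ?_
    have h1 := eventTime_succ_pos hX n
    have h2 := jump_nonneg (X := X) hd hV n
    rw [intervalIntegral.integral_sub (monotone_ite_le _).intervalIntegrable
      (monotone_ite_le _).intervalIntegrable, integral_ite_le h1 hT0,
      integral_ite_le (by linarith) hT0]
  · exact fun n _ => (monotone_ite_le _).intervalIntegrable.sub
      (monotone_ite_le _).intervalIntegrable
  · intro t ht
    rw [Set.uIcc_of_le hT0] at ht
    exact distortion_eq_sum hd hX hV ht.1 (ht.2.trans_lt hT)

/-- Sandwich: the integral is at most the total delay of all events up to T, and at least the total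
delay of events already delivered by T. Arrival and delivery times grow at the same rate, so both
bounds have the same limit. -/
theorem tendsto_averageDistortion (hd : 0 < d) (hX : ∀ n, 0 < X n ω) (hV : ∀ n, 0 ≤ V n ω)
    {a c : ℝ} (ha : 0 < a) (hs : Tendsto (fun n : ℕ => eventTime X n ω / n) atTop (𝓝 a))
    (hY : Tendsto (fun m : ℕ => (∑ n ∈ Finset.range m, IsSampledSource.jump d X V n ω) / m) atTop
      (𝓝 c)) :
    Tendsto (fun T => averageDistortion d X V T ω) atTop (𝓝 (c / a)) := by
  set Y : ℕ → ℝ := fun m => ∑ n ∈ Finset.range m, IsSampledSource.jump d X V n ω with hYdef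
  set R : ℕ → ℝ := fun n => eventTime X (n + 1) ω + IsSampledSource.jump d X V n ω with hRdef
  -- A single delay is a difference of consecutive partial sums, hence negligible against n.
  have hR : Tendsto (fun n : ℕ => R n / n) atTop (𝓝 a) := by
    have h1 := (tendsto_succ_div hs).add ((tendsto_succ_div hY).sub hY)
    rw [sub_self, add_zero] at h1
    refine h1.congr fun n => ?_
    simp only [hRdef, Finset.sum_range_succ]
    ring
  -- First-in-first-out: events are delivered in order of occurrence.
  have hRmono : Monotone R := fun m n hmn => by
    simp only [hRdef, ← deliveryTime_ceil]
    refine monotone_deliveryTime hV (Nat.ceil_mono ?_)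
    have := (strictMono_eventTime hX).monotone (Nat.succ_le_succ hmn)
    exact div_le_div_of_nonneg_right this hd.le
  obtain ⟨N, hN⟩ := exists_index_of_tendsto_atTop (tendsto_atTop_of_tendsto_div ha hs)
  obtain ⟨M, hM⟩ := exists_index_of_tendsto_atTop (tendsto_atTop_of_tendsto_div ha hR)
  refine tendsto_of_tendsto_of_tendsto_of_le_of_le' (tendsto_comp_index_div ha hR hY hM)
    (tendsto_comp_index_div ha hs hY hN) ?_ ?_
  · filter_upwards [eventually_gt_atTop 0, eventually_ge_atTop (R 0)] with T hT hTR
    have h1 := hN T (by simpa [eventTime] using hT.le)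
    have h2 := hM T hTR
    rw [averageDistortion, integral_distortion hd hX hV hT.le h1.2, one_div, div_eq_inv_mul]
    refine mul_le_mul_of_nonneg_left ?_ (inv_nonneg.2 hT.le)
    have hMN : M T ≤ N T := by
      have h3 : eventTime X (M T + 1) ω ≤ R (M T) := by
        linarith [jump_nonneg (X := X) hd hV (M T), show R (M T) = eventTime X (M T + 1) ω +
          IsSampledSource.jump d X V (M T) ω from rfl]
      have h4 := (strictMono_eventTime hX).lt_iff_lt.1 ((h3.trans h2.1).trans_lt h1.2)
      omega
    calc Y (M T) ≤ ∑ n ∈ Finset.range (M T), (max (T - eventTime X (n + 1) ω) 0 -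
          max (T - (eventTime X (n + 1) ω + IsSampledSource.jump d X V n ω)) 0) := by
          refine Finset.sum_le_sum fun n hn => ?_
          have h3 : R n ≤ T := (hRmono (Finset.mem_range.1 hn).le).trans h2.1
          have h4 := jump_nonneg (X := X) hd hV n
          simp only [hRdef] at h3
          rw [max_eq_left (by linarith), max_eq_left (by linarith)]
          linarith
      _ ≤ _ := by
          refine Finset.sum_le_sum_of_subset_of_nonneg (Finset.range_mono hMN) fun n _ _ => ?_
          have h4 := jump_nonneg (X := X) hd hV n
          rw [sub_nonneg]
          exact max_le_max_right 0 (by linarith)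
  · filter_upwards [eventually_gt_atTop 0] with T hT
    have h1 := hN T (by simpa [eventTime] using hT.le)
    rw [averageDistortion, integral_distortion hd hX hV hT.le h1.2, one_div, div_eq_inv_mul]
    refine mul_le_mul_of_nonneg_left (Finset.sum_le_sum fun n hn => ?_) (inv_nonneg.2 hT.le)
    have h3 : eventTime X (n + 1) ω ≤ T :=
      ((strictMono_eventTime hX).monotone (Nat.succ_le_of_lt (Finset.mem_range.1 hn))).trans h1.1
    rw [max_eq_left (by linarith)]
    linarith [le_max_left (T - (eventTime X (n + 1) ω + IsSampledSource.jump d X V n ω)) 0]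

end SamplePath

/-! ### The long-run average distortion -/

theorem ae_tendsto_eventTime_div {Ω : Type*} [MeasurableSpace Ω] {P : Measure Ω}
    {lam : ℝ} (hlam : 0 < lam) {X : ℕ → Ω → ℝ}
    (hX : ∀ n, HasLaw (X n) (expMeasure lam) P) (h : iIndepFun X P) :
    ∀ᵐ ω ∂P, Tendsto (fun n : ℕ => eventTime X n ω / n) atTop (𝓝 (1 / lam)) := by
  have := h.isProbabilityMeasure
  have := isProbabilityMeasure_expMeasure hlam
  have hi : Integrable (X 0) P := by
    have h1 := (memLp_two_expMeasure hlam).integrable one_le_two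
    rw [← (hX 0).map_eq] at h1
    exact (integrable_map_measure (by fun_prop) (hX 0).aemeasurable).1 h1
  have h1 := strong_law_ae_real X hi (fun i j hij => h.indepFun hij) fun i =>
    ⟨(hX i).aemeasurable, (hX 0).aemeasurable, by rw [(hX i).map_eq, (hX 0).map_eq]⟩
  rw [(hX 0).integral_eq, integral_id_expMeasure hlam] at h1
  exact h1

theorem hasLaw_infinitePi_elim {Ω : Type*} [MeasurableSpace Ω] {P : Measure Ω} {lam μ : ℝ}
    {X V : ℕ → Ω → ℝ} [∀ i, IsProbabilityMeasure ((Sum.elim (fun _ => expMeasure lam)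
      fun _ => expMeasure μ : ℕ ⊕ ℕ → Measure ℝ) i)]
    (hX : ∀ n, HasLaw (X n) (expMeasure lam) P)
    (hV : ∀ n, HasLaw (V n) (expMeasure μ) P) (hindep : iIndepFun (Sum.elim X V) P) :
    HasLaw (fun ω i => Sum.elim X V i ω) (Measure.infinitePi (Sum.elim (fun _ => expMeasure lam)
      fun _ => expMeasure μ : ℕ ⊕ ℕ → Measure ℝ)) P := by
  have h1 : ∀ i, HasLaw (Sum.elim X V i) ((Sum.elim (fun _ => expMeasure lam)
      fun _ => expMeasure μ : ℕ ⊕ ℕ → Measure ℝ) i) P := by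
    rintro (i | i)
    exacts [hX i, hV i]
  exact hindep.hasLaw_infinitePi h1 (aemeasurable_pi_iff.2 fun i => (h1 i).aemeasurable)

/-- There is a space carrying the source, the service times and a stationary initial state. -/
theorem exists_stationary_model {lam θ μ d : ℝ} (hlam : 0 < lam) (hd : 0 < d) (hθ : 0 < θ)
    (hθμ : θ < μ) (he : Real.exp (-(θ * d)) = (μ - θ) / μ) :
    ∃ (Ω : Type) (_ : MeasurableSpace Ω) (P : Measure Ω) (X V : ℕ → Ω → ℝ),
      (∀ n, HasLaw (X n) (expMeasure lam) P) ∧ (∀ n, HasLaw (V n) (expMeasure μ) P) ∧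
      iIndepFun (Sum.elim X V) P ∧
      ∀ᵐ ω ∂P, Tendsto (fun m : ℕ => (∑ n ∈ Finset.range m, IsSampledSource.jump d X V n ω) / m)
        atTop (𝓝 (1 / θ + d / 2)) := by
  have hμ := hθ.trans hθμ
  have ilam := isProbabilityMeasure_expMeasure hlam
  have iθ := isProbabilityMeasure_expMeasure hθ
  have iμ := isProbabilityMeasure_expMeasure hμ
  -- Left indices carry the interarrival times, right index 0 the stationary initial sojourn time,
  -- and the other right indices the service times.
  set a : ℕ ⊕ ℕ → ℝ := Sum.elim (fun _ => lam) fun k => Nat.casesOn k θ fun _ => μ with hadef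
  have ha : ∀ i, 0 < a i := by
    rintro (i | _ | i)
    exacts [hlam, hθ, hμ]
  have hinst : ∀ i, IsProbabilityMeasure (expMeasure (a i)) := fun i =>
    isProbabilityMeasure_expMeasure (ha i)
  obtain ⟨Ω, mΩ, P, G₀, hGm₀, hGlaw₀, hGi₀, hP⟩ :=
    exists_hasLaw_indepFun (fun _ : ℕ ⊕ ℕ => ℝ) (fun i => expMeasure (a i))
  have hpm : Measurable fun x : ℝ => if 0 < x then x else 1 :=
    Measurable.ite measurableSet_Ioi measurable_id measurable_const
  -- Nonnegativity is required at every ω; the value 1 on a null set is arbitrary.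
  set G : ℕ ⊕ ℕ → Ω → ℝ := fun i ω => if 0 < G₀ i ω then G₀ i ω else 1 with hG
  have hGm : ∀ i, Measurable (G i) := fun i => hpm.comp (hGm₀ i)
  have hGi : iIndepFun G P := hGi₀.comp (fun _ x => if 0 < x then x else 1) fun _ => hpm
  have hGpos : ∀ i ω, 0 ≤ G i ω := fun i ω => by
    simp only [hG]
    split_ifs with h
    exacts [h.le, zero_le_one]
  have hGlaw : ∀ i, HasLaw (G i) (expMeasure (a i)) P := fun i => by
    refine (hGlaw₀ i).congr ?_
    have h1 := ((hGlaw₀ i).ae_iff (p := fun x => 0 < x) (measurableSet_setOfPred.1 measurableSet_Ioi)).2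
      (ae_pos_expMeasure (ha i))
    filter_upwards [h1] with ω hω
    simp only [hG, if_pos hω]
  set X : ℕ → Ω → ℝ := fun n => G (Sum.inl n) with hX
  set V : ℕ → Ω → ℝ := fun n => G (Sum.inr (n + 1)) with hV
  have hXlaw : ∀ n, HasLaw (X n) (expMeasure lam) P := fun n => hGlaw (Sum.inl n)
  have hVlaw : ∀ n, HasLaw (V n) (expMeasure μ) P := fun n => hGlaw (Sum.inr (n + 1))
  have hQ : IsStationaryQueue P d θ μ fun k => G (Sum.inr k) :=
    ⟨hd, hθ, hθμ, he, fun i => hGm _, fun i => hGpos _, hGi.precomp Sum.inr_injective,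
      hGlaw (Sum.inr 0), hVlaw⟩
  have hXV : iIndepFun (Sum.elim X V) P := by
    have h1 := hGi.precomp (g := Sum.map id Nat.succ)
      (Function.Injective.sumMap Function.injective_id Nat.succ_injective)
    convert! h1 using 1
    funext i
    rcases i with i | i <;> rfl
  obtain ⟨K, hK0, hK⟩ := hQ.exists_integral_sojourn_sq_le
  have hS : IsSampledSource P d lam K X V :=
    ⟨hd, hlam, hK0, fun n => hGm _, fun n => hGm _, fun n => hGpos _, fun n => hGpos _, hXV, hXlaw, hK⟩
  exact ⟨Ω, mΩ, P, X, V, hXlaw, hVlaw, hXV, hS.ae_tendsto_average_jump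
    (ae_tendsto_eventTime_div hlam hXlaw (hGi.precomp Sum.inl_injective))
    hQ.ae_tendsto_sojourn_average⟩

/-- The claim concerns a measurable set of paths of (X, V), whose law is the same product measure on
both spaces. -/
theorem ae_tendsto_average_jump_of_iIndepFun {Ω : Type*} [MeasurableSpace Ω] {P : Measure Ω}
    {lam θ μ d : ℝ} (hlam : 0 < lam) (hd : 0 < d) (hθ : 0 < θ) (hθμ : θ < μ)
    (he : Real.exp (-(θ * d)) = (μ - θ) / μ) {X V : ℕ → Ω → ℝ}
    (hX : ∀ n, HasLaw (X n) (expMeasure lam) P) (hV : ∀ n, HasLaw (V n) (expMeasure μ) P)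
    (hindep : iIndepFun (Sum.elim X V) P) :
    ∀ᵐ ω ∂P, Tendsto (fun m : ℕ => (∑ n ∈ Finset.range m, IsSampledSource.jump d X V n ω) / m)
      atTop (𝓝 (1 / θ + d / 2)) := by
  obtain ⟨Ω', mΩ', P', X', V', hX', hV', hindep', h'⟩ := exists_stationary_model hlam hd hθ hθμ he
  have hinst : ∀ i, IsProbabilityMeasure ((Sum.elim (fun _ => expMeasure lam)
      fun _ => expMeasure μ : ℕ ⊕ ℕ → Measure ℝ) i) := by
    rintro (i | i)
    exacts [isProbabilityMeasure_expMeasure hlam, isProbabilityMeasure_expMeasure (hθ.trans hθμ)]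
  have hm : MeasurableSet {z : ℕ ⊕ ℕ → ℝ | Tendsto (fun m : ℕ => (∑ n ∈ Finset.range m,
      IsSampledSource.jump d (fun n z => z (Sum.inl n)) (fun n z => z (Sum.inr n)) n z) / m)
      atTop (𝓝 (1 / θ + d / 2))} := by
    refine measurableSet_tendsto _ fun m => Measurable.div_const
      (Finset.measurable_fun_sum _ fun n _ => ?_) _
    exact IsSampledSource.measurable_jump (fun j => measurable_pi_apply _)
      fun k _ => measurable_pi_apply _
  have h1 := ((hasLaw_infinitePi_elim hX' hV' hindep').ae_iff (measurableSet_setOfPred.1 hm)).1 h'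
  exact ((hasLaw_infinitePi_elim hX hV hindep).ae_iff (measurableSet_setOfPred.1 hm)).2 h1

/-- The root `σ` of `σ = exp (-(μ * (1 - σ)) / r)` given by the Lambert function. -/
theorem lambertW_root {μ r σ : ℝ} (hr : 0 < r) (hrμ : r < μ)
    (hσ : σ = -(r / μ) * lambertW (-(μ / r) * Real.exp (-(μ / r)))) :
    0 < σ ∧ σ < 1 ∧ Real.exp (-(μ * (1 - σ) * (1 / r))) = σ := by
  have hμ : 0 < μ := hr.trans hrμ
  obtain ⟨h1, h2⟩ := lambertW_spec (x := -(μ / r) * Real.exp (-(μ / r))) (by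
    -- Shows that the argument is at least -1/e: x ≤ exp(x - 1) at x = μ / r.
    have h3 := Real.add_one_le_exp (μ / r - 1)
    have h4 : Real.exp (-1) = Real.exp (μ / r - 1) * Real.exp (-(μ / r)) := by
      rw [← Real.exp_add]; ring_nf
    rw [h4]
    nlinarith [Real.exp_pos (-(μ / r))])
  set w := lambertW (-(μ / r) * Real.exp (-(μ / r))) with hw
  have hwσ : w = -(μ / r) * σ := by rw [hσ]; field_simp
  have hwneg : w < 0 := by
    have h3 : 0 < μ / r * Real.exp (-(μ / r)) := by positivity
    by_contra! hcon
    have : 0 ≤ w * Real.exp w := by positivity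
    linarith
  have hρ : 0 < r / μ := by positivity
  have hρ1 : r / μ < 1 := (div_lt_one hμ).2 hrμ
  -- From -1 ≤ w < 0 follows 0 < σ ≤ r / μ < 1; the principal branch thus excludes the trivial root
  -- w = -μ / r, σ = 1.
  refine ⟨by rw [hσ]; nlinarith, by rw [hσ]; nlinarith, ?_⟩
  have hμr : 0 < μ / r := by positivity
  have h5 : σ * Real.exp (-(μ / r) * σ) = Real.exp (-(μ / r)) := by
    rw [hwσ] at h2
    have : -(μ / r) * (σ * Real.exp (-(μ / r) * σ)) = -(μ / r) * Real.exp (-(μ / r)) := by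
      linarith
    exact mul_left_cancel₀ (neg_ne_zero.2 hμr.ne') this
  have h6 : -(μ * (1 - σ) * (1 / r)) = -(μ / r) - -(μ / r) * σ := by field_simp; ring
  rw [h6, Real.exp_sub, ← h5, mul_div_assoc, div_self (Real.exp_ne_zero _), mul_one]

theorem theorem1 {Ω : Type*} [MeasurableSpace Ω] (P : Measure Ω) [IsProbabilityMeasure P]
    (lam μ r : ℝ) (hlam : 0 < lam) (hr : 0 < r) (hrμ : r < μ)
    (X V : ℕ → Ω → ℝ)
    (hX : ∀ n, HasLaw (X n) (expMeasure lam) P)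
    (hV : ∀ n, HasLaw (V n) (expMeasure μ) P)
    (hindep : iIndepFun (Sum.elim X V) P)
    (σ : ℝ) (hσ : σ = -(r / μ) * lambertW (-(μ / r) * Real.exp (-(μ / r)))) :
    ∀ᵐ ω ∂P,
      (∀ T : ℝ, IntervalIntegrable (fun t => distortion (1 / r) X V t ω) volume 0 T) ∧
      Tendsto (fun T : ℝ => averageDistortion (1 / r) X V T ω) atTop
        (𝓝 (lam * (1 / (2 * r) + σ / (μ * (1 - σ)) + 1 / μ))) := by
  have hμ : 0 < μ := hr.trans hrμ
  have hd : 0 < 1 / r := by positivity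
  obtain ⟨hσ0, hσ1, hσe⟩ := lambertW_root hr hrμ hσ
  have hσ' : 0 < 1 - σ := by linarith
  have hpos : ∀ {a : ℝ} {Y : Ω → ℝ}, 0 < a → HasLaw Y (expMeasure a) P → ∀ᵐ ω ∂P, 0 < Y ω :=
    fun ha hY => (hY.ae_iff (p := fun x => 0 < x) (measurableSet_setOfPred.1 measurableSet_Ioi)).2
      (ae_pos_expMeasure ha)
  have hj := ae_tendsto_average_jump_of_iIndepFun (θ := μ * (1 - σ)) hlam hd (by positivity)
    (by nlinarith) (by rw [hσe]; field_simp; ring) hX hV hindep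
  filter_upwards [ae_all_iff.2 fun n => hpos hlam (hX n), ae_all_iff.2 fun n => hpos hμ (hV n),
    ae_tendsto_eventTime_div hlam hX (hindep.precomp (g := Sum.inl) Sum.inl_injective), hj] with ω h1 h2 h3 h4
  refine ⟨intervalIntegrable_distortion hd h1 (fun n => (h2 n).le)
    (tendsto_atTop_of_tendsto_div (one_div_pos.2 hlam) h3), ?_⟩
  have h5 := tendsto_averageDistortion hd h1 (fun n => (h2 n).le) (one_div_pos.2 hlam) h3 h4
  -- Uses 1/(μ(1 - σ)) = σ/(μ(1 - σ)) + 1/μ.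
  convert h5 using 2
  field_simp
  ring
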